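/- Let $\mathbb K$ be an algebraically closed field of characteristic $0$. **Definitions.** A superalgebra is a vector space $\mathcal A=\mathcal A_{\bar 0}\oplus\mathcal A_{\bar 1}$ with a bilinear product such that $\mathcal A_i\bullet\mathcal A_j\subseteq\mathcal A_{i+j}$. It is a *Novikov superalgebra* if for all homogeneous $u,v,w$, with $(u,v,w)=(u\bullet v)\bullet w-u\bullet(v\bullet w)$, $$(u,v,w)=(-1)^{|u||v|}(v,u,w),\qquad (w\bullet u)\bullet v=(-1)^{|u||v|}(w\bullet v)\bullet u .$$ It is *pseudo-Euclidean* if it carries a non-degenerate bilinear form with $\langle u,v\rangle=(-1)^{|u||v|}\langle v,u\rangle$ and $\langle u\bullet v,w\rangle=-(-1)^{|u||v|}\langle v,u\bullet w\rangle$ for homogeneous $u,v,w$. It is called *even* if $\langle\mathcal A_{\bar 0},\mathcal A_{\bar 1}\rangle=\langle\mathcal A_{\bar 1},\mathcal A_{\bar 0}\rangle=0$ and *odd* if $\langle\mathcal A_{i},\mathcal A_{i}\rangle=0$ for $i=\bar 0,\bar 1$. $\mathcal A\bullet\mathcal A$ denotes the span of all products; it is *degenerate* if the form restricted to it is degenerate.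 An isomorphism is a linear bijection preserving parity, product and form. Bases are written (even vectors $|$ odd vectors); only the non-zero products of basis vectors and the non-zero values of the form are listed, the remaining values of the form being determined by the symmetry $\langle u,v\rangle=(-1)^{|u||v|}\langle v,u\rangle$. **Theorem.** (1) Each of the superalgebras $\mathcal A^4_7,\dots,\mathcal A^4_{13}$ below is an even pseudo-Euclidean Novikov superalgebra, and every even pseudo-Euclidean Novikov superalgebra $\mathcal A$ of total dimension $4$ for which $\mathcal A\bullet\mathcal A$ is degenerate is isomorphic to one of them. Here $\epsilon,\rho\in\{1,-1\}$, and all other parameters are arbitrary in $\mathbb K$ unless a restriction is given. * $\mathcal A^4_7$, basis $(e,e_1,e_2,d\,|\,)$: $d\bullet e_1=-a\epsilon e_2-\alpha e$, $d\bullet e_2=ae_1-\beta\epsilon e$, $d\bullet d=\alpha e_1+\beta e_2$; $\langle e,d\rangle=\langle e_1,e_1\rangle=1$, $\langle e_2,e_2\rangle=\epsilon$. * $\mathcal A^4_8$, basis $(e,e_1,e_2,d\,|\,)$, $a\ne0$: $e_2\bullet e_1=-a\epsilon e$, $e_2\bullet d=ae_1$, $d\bullet e_1=-\alpha\epsilon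 e$, $d\bullet d=\alpha e_1$; $\langle e,d\rangle=1$, $\langle e_1,e_1\rangle=\epsilon$, $\langle e_2,e_2\rangle=\rho$. * $\mathcal A^4_9$, basis $(e,e_1,e_2,d\,|\,)$, $a\ne0$: $e_2\bullet e_2=-ae$, $e_2\bullet d=ae_1$, $d\bullet e_2=-\alpha e$, $d\bullet d=\alpha e_1$; $\langle e,d\rangle=\langle e_1,e_2\rangle=1$. * $\mathcal A^4_{10}$, basis $(e,d\,|\,e_1,e_2)$: $d\bullet e_1=ae_1$, $d\bullet e_2=-ae_2$; $\langle e,d\rangle=\langle e_1,e_2\rangle=1$. * $\mathcal A^4_{11}$, basis $(e,d\,|\,e_1,e_2)$, $a\neq0$: $e_2\bullet e_2=-ae$, $e_2\bullet d=ae_1$; $\langle e,d\rangle=\langle e_1,e_2\rangle=1$. * $\mathcal A^4_{12}$, basis $(e_1,e_2\,|\,e,d)$: $e_1\bullet d=\alpha e$, $e_2\bullet d=\epsilon\beta e$; $\langle e_1,e_1\rangle=1$, $\langle e_2,e_2\rangle=\epsilon$, $\langle e,d\rangle=1$. * $\mathcal A^4_{13}$, basis $(e_1,e_2\,|\,e,d)$,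 $\lambda\ne0$: $e_2\bullet d=\alpha e$, $d\bullet d=\lambda e_1$, $d\bullet e_2=-\lambda e$; $\langle e_1,e_2\rangle=\langle e,d\rangle=1$. (2) Each of the superalgebras $\mathcal A^4_{14},\dots,\mathcal A^4_{19}$ below is an odd pseudo-Euclidean Novikov superalgebra, and every odd pseudo-Euclidean Novikov superalgebra of total dimension $4$ is isomorphic to one of them. In all of them $\langle e,d\rangle=\langle e_1,f_1\rangle=1$. * $\mathcal A^4_{14}$, basis $(d,e_1\,|\,f_1,e)$: $d\bullet e_1=ae_1$, $d\bullet f_1=-af_1-\alpha e$, $d\bullet d=\alpha e_1$. * $\mathcal A^4_{15}$, basis $(e,e_1\,|\,f_1,d)$: $d\bullet f_1=\alpha e$, $f_1\bullet d=\beta e$, $d\bullet d=\alpha e_1$. * $\mathcal A^4_{16}$, basis $(e,e_1\,|\,f_1,d)$, $a\ne0$: $e_1\bullet d=af_1$, $e_1\bullet e_1=-ae$. * $\mathcal A^4_{17}$, basis $(e,e_1\,|\,f_1,d)$, $a\ne0$: $d\bullet f_1=\alpha e$, $f_1\bullet d=ae_1+\beta e$, $f_1\bullet f_1=ae$, $d\bullet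 d=\alpha e_1$. * $\mathcal A^4_{18}$, basis $(d,e_1\,|\,f_1,e)$, $\alpha\ne0$: $d\bullet f_1=-\beta e$, $f_1\bullet f_1=\alpha e_1$, $d\bullet d=\beta e_1$. * $\mathcal A^4_{19}$, basis $(e,e_1\,|\,f_1,d)$, $\alpha\ne0$: $d\bullet f_1=be_1+\beta e$, $f_1\bullet d=ae_1+\lambda e$, $f_1\bullet f_1=\alpha e_1+ae$, $d\bullet d=\beta e_1$. -/

import Mathlib

/-- The data of a `ZMod 2`-graded vector space with a bilinear product and a bilinear form.
The laws are the predicates below. -/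
structure FormedSuperalgebra (K A : Type*) [Field K] [AddCommGroup A] [Module K A] where
  /-- the homogeneous subspaces: `part 0` is the even part, `part 1` is the odd part -/
  part : ZMod 2 → Submodule K A
  /-- the product `u • v` -/
  mul : A →ₗ[K] A →ₗ[K] A
  /-- the bilinear form `⟨u, v⟩` -/
  form : LinearMap.BilinForm K A

namespace FormedSuperalgebra

/-- The sign `(-1)^{ij}` for parities `i`, `j`: it is `-1` exactly when both are odd. -/
def koszul (K : Type*) [Field K] (i j : ZMod 2) : K := if i = 1 ∧ j = 1 then -1 else 1

section Laws

variable {K A : Type*} [Field K] [AddCommGroup A] [Module K A]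

/-- `A` is the direct sum of its even and its odd part, and the product respects parity. -/
structure IsSuperalgebra (S : FormedSuperalgebra K A) : Prop where
  isCompl : IsCompl (S.part 0) (S.part 1)
  mul_mem : ∀ (i j : ZMod 2) (u v : A), u ∈ S.part i → v ∈ S.part j → S.mul u v ∈ S.part (i + j)

/-- The associator `(u, v, w) = (u • v) • w - u • (v • w)`. -/
def assoc (S : FormedSuperalgebra K A) (u v w : A) : A :=
  S.mul (S.mul u v) w - S.mul u (S.mul v w)

/-- Novikov superalgebra: left-symmetric, and right multiplications supercommute. -/
structure IsNovikov (S : FormedSuperalgebra K A) : Prop extends S.IsSuperalgebra where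
  left_symm : ∀ (i j : ZMod 2) (u v w : A), u ∈ S.part i → v ∈ S.part j →
    S.assoc u v w = koszul K i j • S.assoc v u w
  right_comm : ∀ (i j : ZMod 2) (u v w : A), u ∈ S.part i → v ∈ S.part j →
    S.mul (S.mul w u) v = koszul K i j • S.mul (S.mul w v) u

/-- Pseudo-Euclidean Novikov superalgebra: a Novikov superalgebra with a non-degenerate
(super)symmetric form for which the left multiplications are antisymmetric. -/
structure IsPseudoEuclideanNovikov (S : FormedSuperalgebra K A) : Prop extends S.IsNovikov where
  form_symm : ∀ (i j : ZMod 2) (u v : A), u ∈ S.part i → v ∈ S.part j →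
    S.form u v = koszul K i j * S.form v u
  form_nondegenerate : ∀ u : A, (∀ v : A, S.form v u = 0) → u = 0
  left_antisymm : ∀ (i j : ZMod 2) (u v w : A), u ∈ S.part i → v ∈ S.part j →
    S.form (S.mul u v) w = -(koszul K i j * S.form v (S.mul u w))

/-- The form is even: it vanishes on pairs of vectors of different parities. -/
def FormIsEven (S : FormedSuperalgebra K A) : Prop :=
  ∀ (i j : ZMod 2) (u v : A), i ≠ j → u ∈ S.part i → v ∈ S.part j → S.form u v = 0

/-- The form is odd: it vanishes on pairs of vectors of the same parity. -/
def FormIsOdd (S : FormedSuperalgebra K A) : Prop :=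
  ∀ (i : ZMod 2) (u v : A), u ∈ S.part i → v ∈ S.part i → S.form u v = 0

/-- The product space `A • A`, spanned by all products. -/
def square (S : FormedSuperalgebra K A) : Submodule K A :=
  Submodule.span K {z | ∃ u v : A, z = S.mul u v}

/-- `A • A` is degenerate: the form restricted to `A • A` has a non-zero radical. -/
def SquareDegenerate (S : FormedSuperalgebra K A) : Prop :=
  ∃ x ∈ S.square, x ≠ 0 ∧ ∀ y ∈ S.square, S.form y x = 0

/-- Isomorphism: a linear bijection preserving parity, product and form. -/
def Isomorphic {B : Type*} [AddCommGroup B] [Module K B]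
    (S : FormedSuperalgebra K A) (T : FormedSuperalgebra K B) : Prop :=
  ∃ φ : A ≃ₗ[K] B,
    (∀ (i : ZMod 2) (u : A), φ u ∈ T.part i ↔ u ∈ S.part i) ∧
    (∀ u v : A, φ (S.mul u v) = T.mul (φ u) (φ v)) ∧
    (∀ u v : A, T.form (φ u) (φ v) = S.form u v)

end Laws

section Models

variable {K : Type*} [Field K]

/-- The superspace `K⁴` with standard basis `b 0, …, b 3`, where `b k` has parity `p k`,
the product `b i • b j = m i j`, and the form `⟨b i, b j⟩ = g i j`. -/
noncomputable def ofTable (p : Fin 4 → ZMod 2) (m : Fin 4 → Fin 4 → (Fin 4 → K))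
    (g : Matrix (Fin 4) (Fin 4) K) : FormedSuperalgebra K (Fin 4 → K) where
  part i := Submodule.span K {x | ∃ k : Fin 4, p k = i ∧ x = Pi.single k 1}
  mul := (Pi.basisFun K (Fin 4)).constr K fun i => (Pi.basisFun K (Fin 4)).constr K (m i)
  form := Matrix.toBilin' g

/- In the tables below a vector `![c₀, c₁, c₂, c₃]` lists the coordinates in the basis named in the
docstring, in that order, and products that are not listed vanish.  For odd `x`, `y` the form
`-(x^* ⊙ y^*)` is the one with `⟨x, y⟩ = 1 = -⟨y, x⟩`. -/

/-- Basis `e, e₁, e₂, d`, all even. -/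
noncomputable def A7 (a α β ε : K) : FormedSuperalgebra K (Fin 4 → K) :=
  ofTable ![0, 0, 0, 0]
    (fun i j => match i, j with
      | 3, 1 => ![-α, 0, -(a * ε), 0]
      | 3, 2 => ![-(β * ε), a, 0, 0]
      | 3, 3 => ![0, α, β, 0]
      | _, _ => 0)
    !![0, 0, 0, 1; 0, 1, 0, 0; 0, 0, ε, 0; 1, 0, 0, 0]

/-- Basis `e, e₁, e₂, d`, all even. -/
noncomputable def A8 (a α ε ρ : K) : FormedSuperalgebra K (Fin 4 → K) :=
  ofTable ![0, 0, 0, 0]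
    (fun i j => match i, j with
      | 2, 1 => ![-(a * ε), 0, 0, 0]
      | 2, 3 => ![0, a, 0, 0]
      | 3, 1 => ![-(α * ε), 0, 0, 0]
      | 3, 3 => ![0, α, 0, 0]
      | _, _ => 0)
    !![0, 0, 0, 1; 0, ε, 0, 0; 0, 0, ρ, 0; 1, 0, 0, 0]

/-- Basis `e, e₁, e₂, d`, all even. -/
noncomputable def A9 (a α : K) : FormedSuperalgebra K (Fin 4 → K) :=
  ofTable ![0, 0, 0, 0]
    (fun i j => match i, j with
      | 2, 2 => ![-a, 0, 0, 0]
      | 2, 3 => ![0, a, 0, 0]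
      | 3, 2 => ![-α, 0, 0, 0]
      | 3, 3 => ![0, α, 0, 0]
      | _, _ => 0)
    !![0, 0, 0, 1; 0, 0, 1, 0; 0, 1, 0, 0; 1, 0, 0, 0]

/-- Basis `e, d | e₁, e₂`. -/
noncomputable def A10 (a : K) : FormedSuperalgebra K (Fin 4 → K) :=
  ofTable ![0, 0, 1, 1]
    (fun i j => match i, j with
      | 1, 2 => ![0, 0, a, 0]
      | 1, 3 => ![0, 0, 0, -a]
      | _, _ => 0)
    !![0, 1, 0, 0; 1, 0, 0, 0; 0, 0, 0, 1; 0, 0, -1, 0]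

/-- Basis `e, d | e₁, e₂`. -/
noncomputable def A11 (a : K) : FormedSuperalgebra K (Fin 4 → K) :=
  ofTable ![0, 0, 1, 1]
    (fun i j => match i, j with
      | 3, 3 => ![-a, 0, 0, 0]
      | 3, 1 => ![0, 0, a, 0]
      | _, _ => 0)
    !![0, 1, 0, 0; 1, 0, 0, 0; 0, 0, 0, 1; 0, 0, -1, 0]

/-- Basis `e₁, e₂ | e, d`. -/
noncomputable def A12 (α β ε : K) : FormedSuperalgebra K (Fin 4 → K) :=
  ofTable ![0, 0, 1, 1]
    (fun i j => match i, j with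
      | 0, 3 => ![0, 0, α, 0]
      | 1, 3 => ![0, 0, ε * β, 0]
      | _, _ => 0)
    !![1, 0, 0, 0; 0, ε, 0, 0; 0, 0, 0, 1; 0, 0, -1, 0]

/-- Basis `e₁, e₂ | e, d`. -/
noncomputable def A13 (l α : K) : FormedSuperalgebra K (Fin 4 → K) :=
  ofTable ![0, 0, 1, 1]
    (fun i j => match i, j with
      | 1, 3 => ![0, 0, α, 0]
      | 3, 3 => ![l, 0, 0, 0]
      | 3, 1 => ![0, 0, -l, 0]
      | _, _ => 0)
    !![0, 1, 0, 0; 1, 0, 0, 0; 0, 0, 0, 1; 0, 0, -1, 0]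

/-- Basis `d, e₁ | f₁, e`. -/
noncomputable def A14 (a α : K) : FormedSuperalgebra K (Fin 4 → K) :=
  ofTable ![0, 0, 1, 1]
    (fun i j => match i, j with
      | 0, 1 => ![0, a, 0, 0]
      | 0, 2 => ![0, 0, -a, -α]
      | 0, 0 => ![0, α, 0, 0]
      | _, _ => 0)
    !![0, 0, 0, 1; 0, 0, 1, 0; 0, 1, 0, 0; 1, 0, 0, 0]

/-- Basis `e, e₁ | f₁, d`. -/
noncomputable def A15 (α β : K) : FormedSuperalgebra K (Fin 4 → K) :=
  ofTable ![0, 0, 1, 1]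
    (fun i j => match i, j with
      | 3, 2 => ![α, 0, 0, 0]
      | 2, 3 => ![β, 0, 0, 0]
      | 3, 3 => ![0, α, 0, 0]
      | _, _ => 0)
    !![0, 0, 0, 1; 0, 0, 1, 0; 0, 1, 0, 0; 1, 0, 0, 0]

/-- Basis `e, e₁ | f₁, d`. -/
noncomputable def A16 (a : K) : FormedSuperalgebra K (Fin 4 → K) :=
  ofTable ![0, 0, 1, 1]
    (fun i j => match i, j with
      | 1, 3 => ![0, 0, a, 0]
      | 1, 1 => ![-a, 0, 0, 0]
      | _, _ => 0)
    !![0, 0, 0, 1; 0, 0, 1, 0; 0, 1, 0, 0; 1, 0, 0, 0]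

/-- Basis `e, e₁ | f₁, d`. -/
noncomputable def A17 (a α β : K) : FormedSuperalgebra K (Fin 4 → K) :=
  ofTable ![0, 0, 1, 1]
    (fun i j => match i, j with
      | 3, 2 => ![α, 0, 0, 0]
      | 2, 3 => ![β, a, 0, 0]
      | 2, 2 => ![a, 0, 0, 0]
      | 3, 3 => ![0, α, 0, 0]
      | _, _ => 0)
    !![0, 0, 0, 1; 0, 0, 1, 0; 0, 1, 0, 0; 1, 0, 0, 0]

/-- Basis `d, e₁ | f₁, e`. -/
noncomputable def A18 (α β : K) : FormedSuperalgebra K (Fin 4 → K) :=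
  ofTable ![0, 0, 1, 1]
    (fun i j => match i, j with
      | 0, 2 => ![0, 0, 0, -β]
      | 2, 2 => ![0, α, 0, 0]
      | 0, 0 => ![0, β, 0, 0]
      | _, _ => 0)
    !![0, 0, 0, 1; 0, 0, 1, 0; 0, 1, 0, 0; 1, 0, 0, 0]

/-- Basis `e, e₁ | f₁, d`. -/
noncomputable def A19 (α l β a b : K) : FormedSuperalgebra K (Fin 4 → K) :=
  ofTable ![0, 0, 1, 1]
    (fun i j => match i, j with
      | 3, 2 => ![β, b, 0, 0]
      | 2, 3 => ![l, a, 0, 0]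
      | 2, 2 => ![a, α, 0, 0]
      | 3, 3 => ![0, β, 0, 0]
      | _, _ => 0)
    !![0, 0, 0, 1; 0, 0, 1, 0; 0, 1, 0, 0; 1, 0, 0, 0]

/-- The list of four-dimensional models with an even form. -/
inductive EvenModel : FormedSuperalgebra K (Fin 4 → K) → Prop
  | A7 (a α β ε : K) (hε : ε = 1 ∨ ε = -1) : EvenModel (A7 a α β ε)
  | A8 (a α ε ρ : K) (ha : a ≠ 0) (hε : ε = 1 ∨ ε = -1) (hρ : ρ = 1 ∨ ρ = -1) :
      EvenModel (A8 a α ε ρ)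
  | A9 (a α : K) (ha : a ≠ 0) : EvenModel (A9 a α)
  | A10 (a : K) : EvenModel (A10 a)
  | A11 (a : K) (ha : a ≠ 0) : EvenModel (A11 a)
  | A12 (α β ε : K) (hε : ε = 1 ∨ ε = -1) : EvenModel (A12 α β ε)
  | A13 (l α : K) (hl : l ≠ 0) : EvenModel (A13 l α)

/-- The list of four-dimensional models with an odd form. -/
inductive OddModel : FormedSuperalgebra K (Fin 4 → K) → Prop
  | A14 (a α : K) : OddModel (A14 a α)
  | A15 (α β : K) : OddModel (A15 α β)
  | A16 (a : K) (ha : a ≠ 0) : OddModel (A16 a)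
  | A17 (a α β : K) (ha : a ≠ 0) : OddModel (A17 a α β)
  | A18 (α β : K) (hα : α ≠ 0) : OddModel (A18 α β)
  | A19 (α l β a b : K) (hα : α ≠ 0) : OddModel (A19 α l β a b)

end Models

end FormedSuperalgebra

namespace FormedSuperalgebra

section Models

variable {K : Type*} [Field K]

section

variable (p : Fin 4 → ZMod 2) (m : Fin 4 → Fin 4 → (Fin 4 → K)) (g : Matrix (Fin 4) (Fin 4) K)

theorem ofTable_mul_single (i j : Fin 4) :
    (ofTable p m g).mul (Pi.single i 1) (Pi.single j 1) = m i j := by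
  have h (k : Fin 4) : (Pi.single k 1 : Fin 4 → K) = Pi.basisFun K (Fin 4) k := by simp
  simp only [ofTable, h, Module.Basis.constr_basis]

theorem ofTable_form_single (i j : Fin 4) :
    (ofTable p m g).form (Pi.single i 1) (Pi.single j 1) = g i j := by
  simp [ofTable, Matrix.toBilin'_single]

theorem ofTable_mul_single_right (i : Fin 4) (v : Fin 4 → K) :
    (ofTable p m g).mul (Pi.single i 1) v = ∑ l, v l • m i l := by
  conv_lhs => rw [pi_eq_sum_univ' v]
  simp [ofTable_mul_single, map_sum]

theorem ofTable_mul_single_left (v : Fin 4 → K) (k : Fin 4) :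
    (ofTable p m g).mul v (Pi.single k 1) = ∑ l, v l • m l k := by
  conv_lhs => rw [pi_eq_sum_univ' v]
  simp [ofTable_mul_single, map_sum, LinearMap.sum_apply]

theorem ofTable_form_single_right (i : Fin 4) (v : Fin 4 → K) :
    (ofTable p m g).form (Pi.single i 1) v = ∑ l, v l * g i l := by
  conv_lhs => rw [pi_eq_sum_univ' v]
  simp [ofTable_form_single, map_sum]

theorem ofTable_form_single_left (v : Fin 4 → K) (k : Fin 4) :
    (ofTable p m g).form v (Pi.single k 1) = ∑ l, v l * g l k := by
  conv_lhs => rw [pi_eq_sum_univ' v]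
  simp [ofTable_form_single, map_sum, LinearMap.sum_apply]

theorem ofTable_eq_vecCons : ofTable p m g = ofTable p
    ![![m 0 0, m 0 1, m 0 2, m 0 3], ![m 1 0, m 1 1, m 1 2, m 1 3],
      ![m 2 0, m 2 1, m 2 2, m 2 3], ![m 3 0, m 3 1, m 3 2, m 3 3]] g := by
  congr 1
  funext i j
  fin_cases i <;> fin_cases j <;> rfl

variable {p m g}

theorem single_mem_ofTable_part {k : Fin 4} {i : ZMod 2} (h : p k = i) :
    Pi.single k 1 ∈ (ofTable p m g).part i :=
  Submodule.subset_span ⟨k, h, rfl⟩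

theorem mem_ofTable_part_iff {i : ZMod 2} {x : Fin 4 → K} :
    x ∈ (ofTable p m g).part i ↔ ∀ k, p k ≠ i → x k = 0 := by
  constructor
  · intro hx k hk
    induction hx using Submodule.span_induction with
    | mem x hx =>
      obtain ⟨l, hl, rfl⟩ := hx
      exact Pi.single_eq_of_ne (by rintro rfl; exact hk hl) _
    | zero => rfl
    | add x y _ _ hx hy => simp [hx, hy]
    | smul c x _ hx => simp [hx]
  · intro h
    rw [pi_eq_sum_univ' x]
    refine Submodule.sum_mem _ fun k _ => ?_
    by_cases hk : p k = i
    · exact Submodule.smul_mem _ _ (single_mem_ofTable_part hk)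
    · simp [h k hk]

/-- A property of pairs of homogeneous vectors that is bilinear in nature holds as soon as it holds
for basis vectors. -/
theorem ofTable_bilinear_induction {P : ZMod 2 → ZMod 2 → (Fin 4 → K) → (Fin 4 → K) → Prop}
    (hb : ∀ k l, P (p k) (p l) (Pi.single k 1) (Pi.single l 1))
    (zero_left : ∀ i j v, P i j 0 v) (zero_right : ∀ i j u, P i j u 0)
    (add_left : ∀ i j u u' v, P i j u v → P i j u' v → P i j (u + u') v)
    (add_right : ∀ i j u v v', P i j u v → P i j u v' → P i j u (v + v'))
    (smul_left : ∀ i j (c : K) u v, P i j u v → P i j (c • u) v)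
    (smul_right : ∀ i j (c : K) u v, P i j u v → P i j u (c • v))
    {i j : ZMod 2} {u v : Fin 4 → K} (hu : u ∈ (ofTable p m g).part i)
    (hv : v ∈ (ofTable p m g).part j) : P i j u v := by
  induction hu using Submodule.span_induction with
  | zero => exact zero_left _ _ _
  | add x y _ _ hx hy => exact add_left _ _ _ _ _ hx hy
  | smul c x _ hx => exact smul_left _ _ _ _ _ hx
  | mem x hx =>
    obtain ⟨k, rfl, rfl⟩ := hx
    induction hv using Submodule.span_induction with
    | zero => exact zero_right _ _ _
    | add x y _ _ hx hy => exact add_right _ _ _ _ _ hx hy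
    | smul c x _ hx => exact smul_right _ _ _ _ _ hx
    | mem y hy =>
      obtain ⟨l, rfl, rfl⟩ := hy
      exact hb k l

theorem ofTable_isCompl : IsCompl ((ofTable p m g).part 0) ((ofTable p m g).part 1) := by
  refine IsCompl.of_eq ?_ ?_
  · rw [Submodule.eq_bot_iff]
    rintro x ⟨h0, h1⟩
    have h0 := mem_ofTable_part_iff.1 h0
    have h1 := mem_ofTable_part_iff.1 h1
    funext k
    by_cases hk : p k = 0
    · exact h1 k (by simp [hk])
    · exact h0 k hk
  · rw [Submodule.eq_top_iff']
    intro x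
    rw [pi_eq_sum_univ' x]
    refine Submodule.sum_mem _ fun k _ => Submodule.smul_mem _ _ ?_
    have h2 : ∀ i : ZMod 2, i = 0 ∨ i = 1 := by decide
    rcases h2 (p k) with hk | hk
    · exact Submodule.mem_sup_left (single_mem_ofTable_part hk)
    · exact Submodule.mem_sup_right (single_mem_ofTable_part hk)

theorem ofTable_isSuperalgebra (hm : ∀ i j k, p k ≠ p i + p j → m i j k = 0) :
    (ofTable p m g).IsSuperalgebra where
  isCompl := ofTable_isCompl
  mul_mem i j u v hu hv := by
    refine ofTable_bilinear_induction (m := m) (g := g)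
      (P := fun i j u v => (ofTable p m g).mul u v ∈ (ofTable p m g).part (i + j))
      ?_ ?_ ?_ ?_ ?_ ?_ ?_ hu hv
    · intro k l
      rw [ofTable_mul_single, mem_ofTable_part_iff]
      exact fun n hn => hm k l n hn
    · simp
    · simp
    · intro i j u u' v h h'
      simpa using add_mem h h'
    · intro i j u u' v h h'
      simpa using add_mem h h'
    · intro i j c u v h
      simpa using Submodule.smul_mem _ c h
    · intro i j c u v h
      simpa using Submodule.smul_mem _ c h

theorem ofTable_mul_mul_eq_zero (h : ∀ i j k n, ∑ l, m i j l * m l k n = 0)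
    (u v w : Fin 4 → K) : (ofTable p m g).mul ((ofTable p m g).mul u v) w = 0 := by
  have hs (k : Fin 4) : Pi.basisFun K (Fin 4) k = (Pi.single k 1 : Fin 4 → K) := by simp
  have key : (ofTable p m g).mul.compr₂ (ofTable p m g).mul = 0 := by
    refine LinearMap.ext_basis (Pi.basisFun K (Fin 4)) (Pi.basisFun K (Fin 4)) fun i j => ?_
    refine (Pi.basisFun K (Fin 4)).ext fun k => ?_
    funext n
    rw [hs, hs, hs, LinearMap.compr₂_apply, ofTable_mul_single, ofTable_mul_single_left]
    simpa using h i j k n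
  have := LinearMap.congr_fun (LinearMap.congr_fun₂ key u v) w
  simpa using this

theorem ofTable_isPseudoEuclideanNovikov
    (hm : ∀ i j k, p k ≠ p i + p j → m i j k = 0)
    (hmm : ∀ i j k n, ∑ l, m i j l * m l k n = 0)
    (hcomm : ∀ i j k n, ∑ l, m j k l * m i l n =
      koszul K (p i) (p j) * ∑ l, m i k l * m j l n)
    (hsymm : ∀ i j, g i j = koszul K (p i) (p j) * g j i)
    (hgg : g * g.transpose = 1)
    (hanti : ∀ i j k, ∑ l, m i j l * g l k = -(koszul K (p i) (p j) * ∑ l, m i k l * g j l)) :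
    (ofTable p m g).IsPseudoEuclideanNovikov where
  toIsSuperalgebra := ofTable_isSuperalgebra hm
  left_symm i j u v w hu hv := by
    simp only [assoc, ofTable_mul_mul_eq_zero hmm, zero_sub, smul_neg, neg_inj]
    refine ofTable_bilinear_induction (m := m) (g := g)
      (P := fun i j u v => (ofTable p m g).mul u ((ofTable p m g).mul v w) =
        koszul K i j • (ofTable p m g).mul v ((ofTable p m g).mul u w))
      ?_ ?_ ?_ ?_ ?_ ?_ ?_ hu hv
    · intro i j
      rw [pi_eq_sum_univ' w]
      simp only [map_sum, map_smul, Finset.smul_sum]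
      refine Finset.sum_congr rfl fun k _ => ?_
      rw [smul_comm (koszul K _ _)]
      congr 1
      funext n
      rw [ofTable_mul_single, ofTable_mul_single, ofTable_mul_single_right,
        ofTable_mul_single_right]
      simpa using hcomm i j k n
    · simp
    · simp
    · intro i j u u' v h h'
      simp [h, h']
    · intro i j u u' v h h'
      simp [h, h']
    · intro i j c u v h
      simp [h, smul_comm c]
    · intro i j c u v h
      simp [h, smul_comm c]
  right_comm i j u v w _ _ := by simp [ofTable_mul_mul_eq_zero hmm]
  form_symm i j u v hu hv := by
    refine ofTable_bilinear_induction (m := m) (g := g)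
      (P := fun i j u v => (ofTable p m g).form u v = koszul K i j * (ofTable p m g).form v u)
      ?_ ?_ ?_ ?_ ?_ ?_ ?_ hu hv
    · intro k l
      simpa [ofTable_form_single] using hsymm k l
    · simp
    · simp
    · intro i j u u' v h h'
      simp [h, h', mul_add]
    · intro i j u u' v h h'
      simp [h, h', mul_add]
    · intro i j c u v h
      simp [h, mul_left_comm c]
    · intro i j c u v h
      simp [h, mul_left_comm c]
  form_nondegenerate u hu := by
    refine Matrix.eq_zero_of_mulVec_eq_zero (Matrix.det_ne_zero_of_right_inverse hgg) ?_
    funext i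
    have := hu (Pi.single i 1)
    rw [ofTable_form_single_right] at this
    simpa [Matrix.mulVec, dotProduct, mul_comm] using this
  left_antisymm i j u v w hu hv := by
    refine ofTable_bilinear_induction (m := m) (g := g)
      (P := fun i j u v => (ofTable p m g).form ((ofTable p m g).mul u v) w =
        -(koszul K i j * (ofTable p m g).form v ((ofTable p m g).mul u w)))
      ?_ ?_ ?_ ?_ ?_ ?_ ?_ hu hv
    · intro i j
      rw [pi_eq_sum_univ' w]
      simp only [map_sum, map_smul, Finset.mul_sum, ← Finset.sum_neg_distrib]
      refine Finset.sum_congr rfl fun k _ => ?_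
      simp only [ofTable_mul_single, ofTable_form_single_right, ofTable_form_single_left,
        smul_eq_mul, hanti]
      ring
    · simp
    · simp
    · intro i j u u' v h h'
      simp [h, h', mul_add]
      ring
    · intro i j u u' v h h'
      simp [h, h', mul_add]
      ring
    · intro i j c u v h
      simp [h, mul_left_comm c]
    · intro i j c u v h
      simp [h, mul_left_comm c]

theorem ofTable_formIsEven (h : ∀ i j, p i ≠ p j → g i j = 0) : (ofTable p m g).FormIsEven := by
  intro i j u v hij hu hv
  refine ofTable_bilinear_induction (m := m) (g := g)
      (P := fun i j u v => i ≠ j → (ofTable p m g).form u v = 0)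
      ?_ ?_ ?_ ?_ ?_ ?_ ?_ hu hv hij
  · intro k l
    rw [ofTable_form_single]
    exact h k l
  · simp
  · simp
  · intro i j u u' v h h' hij
    simp [h hij, h' hij]
  · intro i j u u' v h h' hij
    simp [h hij, h' hij]
  · intro i j c u v h hij
    simp [h hij]
  · intro i j c u v h hij
    simp [h hij]

theorem ofTable_formIsOdd (h : ∀ i j, p i = p j → g i j = 0) : (ofTable p m g).FormIsOdd := by
  intro i u v hu hv
  refine ofTable_bilinear_induction (m := m) (g := g)
      (P := fun i j u v => i = j → (ofTable p m g).form u v = 0)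
      ?_ ?_ ?_ ?_ ?_ ?_ ?_ hu hv rfl
  · intro k l
    rw [ofTable_form_single]
    exact h k l
  · simp
  · simp
  · intro i j u u' v h h' hij
    simp [h hij, h' hij]
  · intro i j u u' v h h' hij
    simp [h hij, h' hij]
  · intro i j c u v h hij
    simp [h hij]
  · intro i j c u v h hij
    simp [h hij]

end

end Models

section Models

variable {K : Type*} [Field K]

theorem one_add_one_zmod_two : (1 + 1 : ZMod 2) = 0 := rfl

theorem A7_laws (a α β ε : K) (hε : ε * ε = 1) :
    (A7 a α β ε).IsPseudoEuclideanNovikov ∧ (A7 a α β ε).FormIsEven := by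
  rw [A7, ofTable_eq_vecCons]
  refine ⟨ofTable_isPseudoEuclideanNovikov ?_ ?_ ?_ ?_ ?_ ?_, ofTable_formIsEven ?_⟩
  · simp [Fin.forall_fin_succ]
  · simp [Fin.forall_fin_succ, Fin.sum_univ_four]
  · simp [Fin.forall_fin_succ, Fin.sum_univ_four, koszul]
  · simp [Fin.forall_fin_succ, koszul]
  · ext i j
    fin_cases i <;> fin_cases j <;> simp [Matrix.mul_apply, Fin.sum_univ_four, hε]
  · simp [Fin.forall_fin_succ, Fin.sum_univ_four, koszul, mul_assoc, hε]
  · simp [Fin.forall_fin_succ]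

theorem A8_laws (a α ε ρ : K) (hε : ε * ε = 1) (hρ : ρ * ρ = 1) :
    (A8 a α ε ρ).IsPseudoEuclideanNovikov ∧ (A8 a α ε ρ).FormIsEven := by
  rw [A8, ofTable_eq_vecCons]
  refine ⟨ofTable_isPseudoEuclideanNovikov ?_ ?_ ?_ ?_ ?_ ?_, ofTable_formIsEven ?_⟩
  · simp [Fin.forall_fin_succ]
  · simp [Fin.forall_fin_succ, Fin.sum_univ_four]
  · simp [Fin.forall_fin_succ, Fin.sum_univ_four, koszul, mul_left_comm a α]
  · simp [Fin.forall_fin_succ, koszul]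
  · ext i j
    fin_cases i <;> fin_cases j <;> simp [Matrix.mul_apply, Fin.sum_univ_four, hε, hρ]
  · simp [Fin.forall_fin_succ, Fin.sum_univ_four, koszul]
  · simp [Fin.forall_fin_succ]

theorem A9_laws (a α : K) :
    (A9 a α).IsPseudoEuclideanNovikov ∧ (A9 a α).FormIsEven := by
  rw [A9, ofTable_eq_vecCons]
  refine ⟨ofTable_isPseudoEuclideanNovikov ?_ ?_ ?_ ?_ ?_ ?_, ofTable_formIsEven ?_⟩
  · simp [Fin.forall_fin_succ]
  · simp [Fin.forall_fin_succ, Fin.sum_univ_four]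
  · simp [Fin.forall_fin_succ, Fin.sum_univ_four, koszul]
  · simp [Fin.forall_fin_succ, koszul]
  · ext i j
    fin_cases i <;> fin_cases j <;> simp [Matrix.mul_apply, Fin.sum_univ_four]
  · simp [Fin.forall_fin_succ, Fin.sum_univ_four, koszul]
  · simp [Fin.forall_fin_succ]

theorem A10_laws (a : K) :
    (A10 a).IsPseudoEuclideanNovikov ∧ (A10 a).FormIsEven := by
  rw [A10, ofTable_eq_vecCons]
  refine ⟨ofTable_isPseudoEuclideanNovikov ?_ ?_ ?_ ?_ ?_ ?_, ofTable_formIsEven ?_⟩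
  · simp [Fin.forall_fin_succ, one_add_one_zmod_two]
  · simp [Fin.forall_fin_succ, Fin.sum_univ_four]
  · simp [Fin.forall_fin_succ, Fin.sum_univ_four, koszul]
  · simp [Fin.forall_fin_succ, koszul]
  · ext i j
    fin_cases i <;> fin_cases j <;> simp [Matrix.mul_apply, Fin.sum_univ_four]
  · simp [Fin.forall_fin_succ, Fin.sum_univ_four, koszul]
  · simp [Fin.forall_fin_succ]

theorem A11_laws (a : K) :
    (A11 a).IsPseudoEuclideanNovikov ∧ (A11 a).FormIsEven := by
  rw [A11, ofTable_eq_vecCons]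
  refine ⟨ofTable_isPseudoEuclideanNovikov ?_ ?_ ?_ ?_ ?_ ?_, ofTable_formIsEven ?_⟩
  · simp [Fin.forall_fin_succ, one_add_one_zmod_two]
  · simp [Fin.forall_fin_succ, Fin.sum_univ_four]
  · simp [Fin.forall_fin_succ, Fin.sum_univ_four, koszul]
  · simp [Fin.forall_fin_succ, koszul]
  · ext i j
    fin_cases i <;> fin_cases j <;> simp [Matrix.mul_apply, Fin.sum_univ_four]
  · simp [Fin.forall_fin_succ, Fin.sum_univ_four, koszul]
  · simp [Fin.forall_fin_succ]

theorem A12_laws (α β ε : K) (hε : ε * ε = 1) :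
    (A12 α β ε).IsPseudoEuclideanNovikov ∧ (A12 α β ε).FormIsEven := by
  rw [A12, ofTable_eq_vecCons]
  refine ⟨ofTable_isPseudoEuclideanNovikov ?_ ?_ ?_ ?_ ?_ ?_, ofTable_formIsEven ?_⟩
  · simp [Fin.forall_fin_succ, one_add_one_zmod_two]
  · simp [Fin.forall_fin_succ, Fin.sum_univ_four]
  · simp [Fin.forall_fin_succ, Fin.sum_univ_four, koszul]
  · simp [Fin.forall_fin_succ, koszul]
  · ext i j
    fin_cases i <;> fin_cases j <;> simp [Matrix.mul_apply, Fin.sum_univ_four, hε]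
  · simp [Fin.forall_fin_succ, Fin.sum_univ_four, koszul]
  · simp [Fin.forall_fin_succ]

theorem A13_laws (l α : K) :
    (A13 l α).IsPseudoEuclideanNovikov ∧ (A13 l α).FormIsEven := by
  rw [A13, ofTable_eq_vecCons]
  refine ⟨ofTable_isPseudoEuclideanNovikov ?_ ?_ ?_ ?_ ?_ ?_, ofTable_formIsEven ?_⟩
  · simp [Fin.forall_fin_succ, one_add_one_zmod_two]
  · simp [Fin.forall_fin_succ, Fin.sum_univ_four]
  · simp [Fin.forall_fin_succ, Fin.sum_univ_four, koszul]
  · simp [Fin.forall_fin_succ, koszul]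
  · ext i j
    fin_cases i <;> fin_cases j <;> simp [Matrix.mul_apply, Fin.sum_univ_four]
  · simp [Fin.forall_fin_succ, Fin.sum_univ_four, koszul]
  · simp [Fin.forall_fin_succ]

theorem A14_laws (a α : K) :
    (A14 a α).IsPseudoEuclideanNovikov ∧ (A14 a α).FormIsOdd := by
  rw [A14, ofTable_eq_vecCons]
  refine ⟨ofTable_isPseudoEuclideanNovikov ?_ ?_ ?_ ?_ ?_ ?_, ofTable_formIsOdd ?_⟩
  · simp [Fin.forall_fin_succ, one_add_one_zmod_two]
  · simp [Fin.forall_fin_succ, Fin.sum_univ_four]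
  · simp [Fin.forall_fin_succ, Fin.sum_univ_four, koszul]
  · simp [Fin.forall_fin_succ, koszul]
  · ext i j
    fin_cases i <;> fin_cases j <;> simp [Matrix.mul_apply, Fin.sum_univ_four]
  · simp [Fin.forall_fin_succ, Fin.sum_univ_four, koszul]
  · simp [Fin.forall_fin_succ]

theorem A15_laws (α β : K) :
    (A15 α β).IsPseudoEuclideanNovikov ∧ (A15 α β).FormIsOdd := by
  rw [A15, ofTable_eq_vecCons]
  refine ⟨ofTable_isPseudoEuclideanNovikov ?_ ?_ ?_ ?_ ?_ ?_, ofTable_formIsOdd ?_⟩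
  · simp [Fin.forall_fin_succ, one_add_one_zmod_two]
  · simp [Fin.forall_fin_succ, Fin.sum_univ_four]
  · simp [Fin.forall_fin_succ, Fin.sum_univ_four, koszul]
  · simp [Fin.forall_fin_succ, koszul]
  · ext i j
    fin_cases i <;> fin_cases j <;> simp [Matrix.mul_apply, Fin.sum_univ_four]
  · simp [Fin.forall_fin_succ, Fin.sum_univ_four, koszul]
  · simp [Fin.forall_fin_succ]

theorem A16_laws (a : K) :
    (A16 a).IsPseudoEuclideanNovikov ∧ (A16 a).FormIsOdd := by
  rw [A16, ofTable_eq_vecCons]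
  refine ⟨ofTable_isPseudoEuclideanNovikov ?_ ?_ ?_ ?_ ?_ ?_, ofTable_formIsOdd ?_⟩
  · simp [Fin.forall_fin_succ, one_add_one_zmod_two]
  · simp [Fin.forall_fin_succ, Fin.sum_univ_four]
  · simp [Fin.forall_fin_succ, Fin.sum_univ_four, koszul]
  · simp [Fin.forall_fin_succ, koszul]
  · ext i j
    fin_cases i <;> fin_cases j <;> simp [Matrix.mul_apply, Fin.sum_univ_four]
  · simp [Fin.forall_fin_succ, Fin.sum_univ_four, koszul]
  · simp [Fin.forall_fin_succ]

theorem A17_laws (a α β : K) :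
    (A17 a α β).IsPseudoEuclideanNovikov ∧ (A17 a α β).FormIsOdd := by
  rw [A17, ofTable_eq_vecCons]
  refine ⟨ofTable_isPseudoEuclideanNovikov ?_ ?_ ?_ ?_ ?_ ?_, ofTable_formIsOdd ?_⟩
  · simp [Fin.forall_fin_succ, one_add_one_zmod_two]
  · simp [Fin.forall_fin_succ, Fin.sum_univ_four]
  · simp [Fin.forall_fin_succ, Fin.sum_univ_four, koszul]
  · simp [Fin.forall_fin_succ, koszul]
  · ext i j
    fin_cases i <;> fin_cases j <;> simp [Matrix.mul_apply, Fin.sum_univ_four]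
  · simp [Fin.forall_fin_succ, Fin.sum_univ_four, koszul]
  · simp [Fin.forall_fin_succ]

theorem A18_laws (α β : K) :
    (A18 α β).IsPseudoEuclideanNovikov ∧ (A18 α β).FormIsOdd := by
  rw [A18, ofTable_eq_vecCons]
  refine ⟨ofTable_isPseudoEuclideanNovikov ?_ ?_ ?_ ?_ ?_ ?_, ofTable_formIsOdd ?_⟩
  · simp [Fin.forall_fin_succ, one_add_one_zmod_two]
  · simp [Fin.forall_fin_succ, Fin.sum_univ_four]
  · simp [Fin.forall_fin_succ, Fin.sum_univ_four, koszul]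
  · simp [Fin.forall_fin_succ, koszul]
  · ext i j
    fin_cases i <;> fin_cases j <;> simp [Matrix.mul_apply, Fin.sum_univ_four]
  · simp [Fin.forall_fin_succ, Fin.sum_univ_four, koszul]
  · simp [Fin.forall_fin_succ]

theorem A19_laws (α l β a b : K) :
    (A19 α l β a b).IsPseudoEuclideanNovikov ∧ (A19 α l β a b).FormIsOdd := by
  rw [A19, ofTable_eq_vecCons]
  refine ⟨ofTable_isPseudoEuclideanNovikov ?_ ?_ ?_ ?_ ?_ ?_, ofTable_formIsOdd ?_⟩
  · simp [Fin.forall_fin_succ, one_add_one_zmod_two]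
  · simp [Fin.forall_fin_succ, Fin.sum_univ_four]
  · simp [Fin.forall_fin_succ, Fin.sum_univ_four, koszul]
  · simp [Fin.forall_fin_succ, koszul]
  · ext i j
    fin_cases i <;> fin_cases j <;> simp [Matrix.mul_apply, Fin.sum_univ_four]
  · simp [Fin.forall_fin_succ, Fin.sum_univ_four, koszul]
  · simp [Fin.forall_fin_succ]

theorem EvenModel.laws {M : FormedSuperalgebra K (Fin 4 → K)} (hM : EvenModel M) :
    M.IsPseudoEuclideanNovikov ∧ M.FormIsEven := by
  cases hM with
  | A7 a α β ε hε => exact A7_laws a α β ε (mul_self_eq_one_iff.2 hε)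
  | A8 a α ε ρ ha hε hρ =>
    exact A8_laws a α ε ρ (mul_self_eq_one_iff.2 hε) (mul_self_eq_one_iff.2 hρ)
  | A9 a α => exact A9_laws a α
  | A10 a => exact A10_laws a
  | A11 a => exact A11_laws a
  | A12 α β ε hε => exact A12_laws α β ε (mul_self_eq_one_iff.2 hε)
  | A13 l α => exact A13_laws l α

theorem OddModel.laws {M : FormedSuperalgebra K (Fin 4 → K)} (hM : OddModel M) :
    M.IsPseudoEuclideanNovikov ∧ M.FormIsOdd := by
  cases hM with
  | A14 a α => exact A14_laws a α
  | A15 α β => exact A15_laws α β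
  | A16 a => exact A16_laws a
  | A17 a α β => exact A17_laws a α β
  | A18 α β => exact A18_laws α β
  | A19 α l β a b => exact A19_laws α l β a b

end Models

section StructureTheory

theorem zmod_two_eq_zero_or_one : ∀ i : ZMod 2, i = 0 ∨ i = 1 := by decide

section Koszul

variable (K : Type*) [Field K]

@[simp] theorem koszul_zero_left (j : ZMod 2) : koszul K 0 j = 1 := by simp [koszul]

@[simp] theorem koszul_zero_right (i : ZMod 2) : koszul K i 0 = 1 := by simp [koszul]

@[simp] theorem koszul_one_one : koszul K 1 1 = -1 := by simp [koszul]

end Koszul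

variable {K A : Type*} [Field K] [AddCommGroup A] [Module K A] {S : FormedSuperalgebra K A}

theorem IsSuperalgebra.exists_add (h : S.IsSuperalgebra) (u : A) :
    ∃ u₀ ∈ S.part 0, ∃ u₁ ∈ S.part 1, u = u₀ + u₁ := by
  have hu : u ∈ S.part 0 ⊔ S.part 1 := by rw [h.isCompl.sup_eq_top]; trivial
  obtain ⟨u₀, h₀, u₁, h₁, rfl⟩ := Submodule.mem_sup.1 hu
  exact ⟨u₀, h₀, u₁, h₁, rfl⟩

theorem IsSuperalgebra.homogeneous_induction (h : S.IsSuperalgebra) {P : A → Prop}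
    (add : ∀ u v, P u → P v → P (u + v)) (homogeneous : ∀ i, ∀ u ∈ S.part i, P u) (u : A) :
    P u := by
  obtain ⟨u₀, h₀, u₁, h₁, rfl⟩ := h.exists_add u
  exact add _ _ (homogeneous 0 _ h₀) (homogeneous 1 _ h₁)

theorem IsSuperalgebra.eq_zero_of_mem (h : S.IsSuperalgebra) {u : A} (h₀ : u ∈ S.part 0)
    (h₁ : u ∈ S.part 1) : u = 0 :=
  (Submodule.disjoint_def.1 h.isCompl.disjoint) u h₀ h₁

theorem IsSuperalgebra.mul_mem' (h : S.IsSuperalgebra) {i j k : ZMod 2} {u v : A}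
    (hu : u ∈ S.part i) (hv : v ∈ S.part j) (hk : i + j = k) : S.mul u v ∈ S.part k :=
  hk ▸ h.mul_mem i j u v hu hv

namespace IsPseudoEuclideanNovikov

theorem exists_form_ne_zero (h : S.IsPseudoEuclideanNovikov) {u : A} (hu : u ≠ 0) :
    ∃ v, S.form v u ≠ 0 := by
  by_contra! hc
  exact hu (h.form_nondegenerate u hc)

theorem eq_zero_of_form_right (h : S.IsPseudoEuclideanNovikov) {i : ZMod 2} {u : A}
    (hu : u ∈ S.part i) (hv : ∀ j, ∀ v ∈ S.part j, S.form u v = 0) : u = 0 := by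
  refine h.form_nondegenerate u
    (h.homogeneous_induction (fun v w hv hw => by simp [hv, hw]) fun j v hv' => ?_)
  rw [h.form_symm j i v u hv' hu, hv j v hv', mul_zero]

theorem mul_mul_eq_zero [CharZero K] (h : S.IsPseudoEuclideanNovikov) (u v w : A) :
    S.mul (S.mul u v) w = 0 := by
  revert u v w
  have key : ∀ i j k l : ZMod 2, ∀ t ∈ S.part l, ∀ u ∈ S.part i, ∀ v ∈ S.part j, ∀ w ∈ S.part k,
      S.form (S.mul (S.mul t u) v) w = 0 := by
    intro i j k l t ht u hu v hv w hw
    have anti : ∀ i j k : ZMod 2, ∀ u ∈ S.part i, ∀ v ∈ S.part j, ∀ w ∈ S.part k,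
        S.form (S.mul (S.mul t u) v) w = -(koszul K j k * S.form (S.mul (S.mul t u) w) v) := by
      intro i j k u hu v hv w hw
      have htu := h.mul_mem l i t u ht hu
      rw [h.left_antisymm _ _ _ _ _ htu hv, h.form_symm _ _ _ _ hv (h.mul_mem _ _ _ _ htu hw)]
      rcases zmod_two_eq_zero_or_one i with rfl | rfl <;>
      rcases zmod_two_eq_zero_or_one j with rfl | rfl <;>
      rcases zmod_two_eq_zero_or_one k with rfl | rfl <;>
      rcases zmod_two_eq_zero_or_one l with rfl | rfl <;>
      simp [one_add_one_zmod_two]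
    have symm : ∀ i j : ZMod 2, ∀ u ∈ S.part i, ∀ v ∈ S.part j, ∀ w,
        S.form (S.mul (S.mul t u) v) w = koszul K i j * S.form (S.mul (S.mul t v) u) w := by
      intro i j u hu v hv w
      rw [h.right_comm i j u v t hu hv]
      simp
    have e1 := symm i j u hu v hv w
    have e2 := anti j i k v hv u hu w hw
    have e3 := symm j k v hv w hw u
    have e4 := anti k j i w hw v hv u hu
    have e5 := symm k i w hw u hu v
    have e6 := anti i k j u hu w hw v hv
    have : S.form (S.mul (S.mul t u) v) w = -S.form (S.mul (S.mul t u) v) w := by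
      conv_lhs => rw [e1, e2, e3, e4, e5, e6]
      rcases zmod_two_eq_zero_or_one i with rfl | rfl <;>
      rcases zmod_two_eq_zero_or_one j with rfl | rfl <;>
      rcases zmod_two_eq_zero_or_one k with rfl | rfl <;>
      simp
    exact self_eq_neg.1 this
  refine h.homogeneous_induction (fun u u' hu hu' v w => by simp [hu, hu']) fun i u hu => ?_
  refine h.homogeneous_induction (fun v v' hv hv' w => by simp [hv, hv']) fun j v hv => ?_
  refine h.homogeneous_induction (fun w w' hw hw' => by simp [hw, hw']) fun k w hw => ?_
  exact h.eq_zero_of_form_right (h.mul_mem _ _ _ _ (h.mul_mem _ _ _ _ hu hv) hw)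
    fun l z hz => key j k l i u hu v hv w hw z hz

theorem mul_left_supercomm [CharZero K] (h : S.IsPseudoEuclideanNovikov) {i j : ZMod 2} {u v : A}
    (hu : u ∈ S.part i) (hv : v ∈ S.part j) (w : A) :
    S.mul u (S.mul v w) = koszul K i j • S.mul v (S.mul u w) := by
  simpa [assoc, h.mul_mul_eq_zero] using h.left_symm i j u v w hu hv

theorem mul_eq_zero_of_mem_square [CharZero K] (h : S.IsPseudoEuclideanNovikov) {x : A}
    (hx : x ∈ S.square) (v : A) : S.mul x v = 0 := by
  induction hx using Submodule.span_induction with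
  | mem x hx =>
    obtain ⟨u, w, rfl⟩ := hx
    exact h.mul_mul_eq_zero u w v
  | zero => simp
  | add x y _ _ hx hy => simp [hx, hy]
  | smul c x _ hx => simp [hx]

theorem mul_eq_zero_of_orthogonal (h : S.IsPseudoEuclideanNovikov) {x : A}
    (hx : ∀ y ∈ S.square, S.form y x = 0) (u : A) : S.mul u x = 0 := by
  revert u
  refine h.homogeneous_induction (fun u v hu hv => by simp [hu, hv]) fun i u hu => ?_
  refine h.form_nondegenerate _ (h.homogeneous_induction (fun v w hv hw => by simp [hv, hw]) ?_)
  intro j v hv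
  have := h.left_antisymm i j u v x hu hv
  rw [hx _ (Submodule.subset_span ⟨u, v, rfl⟩)] at this
  rcases zmod_two_eq_zero_or_one i with rfl | rfl <;>
  rcases zmod_two_eq_zero_or_one j with rfl | rfl <;>
  simpa using this.symm

end IsPseudoEuclideanNovikov

/-- The vectors `v 0, …, v 3` have Gram matrix `g`. -/
def IsFrame (S : FormedSuperalgebra K A) (g : Matrix (Fin 4) (Fin 4) K) (v : Fin 4 → A) : Prop :=
  ∀ i j, S.form (v i) (v j) = g i j

namespace IsFrame

variable {g : Matrix (Fin 4) (Fin 4) K} {v : Fin 4 → A}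

theorem linearIndependent (hv : S.IsFrame g v) (hg : g * g.transpose = 1) :
    LinearIndependent K v := by
  rw [Fintype.linearIndependent_iff]
  intro c hc
  refine congrFun (Matrix.eq_zero_of_vecMul_eq_zero (Matrix.det_ne_zero_of_right_inverse hg) ?_)
  funext j
  have := congrArg (fun x => S.form x (v j)) hc
  simpa [LinearMap.sum_apply, hv _ _, Matrix.vecMul, dotProduct] using this

theorem span_eq_top (hv : S.IsFrame g v) (hg : g * g.transpose = 1)
    (hA : Module.finrank K A = 4) : Submodule.span K (Set.range v) = ⊤ :=
  (hv.linearIndependent hg).span_eq_top_of_card_eq_finrank (by simp [hA])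

/-- The expansion of a vector in a frame whose Gram matrix is orthogonal. -/
theorem eq_sum (hv : S.IsFrame g v) (hg : g * g.transpose = 1)
    (hA : Module.finrank K A = 4) (x : A) :
    x = ∑ k, (∑ l, g l k * S.form (v l) x) • v k := by
  have hx : x ∈ Submodule.span K (Set.range v) := hv.span_eq_top hg hA ▸ Submodule.mem_top
  obtain ⟨c, rfl⟩ := (Submodule.mem_span_range_iff_exists_fun K).1 hx
  refine Finset.sum_congr rfl fun k _ => ?_
  congr 1
  have hg' : g.transpose * g = 1 := mul_eq_one_comm.1 hg
  have : (g.transpose.mulVec (g.mulVec c)) k = c k := by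
    rw [Matrix.mulVec_mulVec, hg', Matrix.one_mulVec]
  rw [← this]
  simp [Matrix.mulVec, dotProduct, hv _ _, mul_comm]

/-- An algebra with a frame in which the products are given by the table `m` is isomorphic to the
algebra of that table. -/
theorem isomorphic_ofTable (hv : S.IsFrame g v) (hg : g * g.transpose = 1)
    (hA : Module.finrank K A = 4) (hS : S.IsSuperalgebra) {p : Fin 4 → ZMod 2}
    {m : Fin 4 → Fin 4 → (Fin 4 → K)} (hp : ∀ k, v k ∈ S.part (p k))
    (hm : ∀ i j, S.mul (v i) (v j) = ∑ l, m i j l • v l) :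
    S.Isomorphic (ofTable p m g) := by
  let b := basisOfLinearIndependentOfCardEqFinrank (hv.linearIndependent hg) (by simp [hA])
  have hb (k : Fin 4) : b k = v k := by simp [b]
  have hφ (k : Fin 4) : b.equivFun (v k) = Pi.single k 1 := by
    rw [← hb]
    funext l
    simp [Pi.single_apply, eq_comm]
  have hφ' (k : Fin 4) : b.equivFun.symm (Pi.single k 1) = v k := by
    rw [← hφ, LinearEquiv.symm_apply_apply]
  have back : ∀ i, ∀ x ∈ (ofTable p m g).part i, b.equivFun.symm x ∈ S.part i := by
    intro i x hx
    induction hx using Submodule.span_induction with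
    | mem x hx =>
      obtain ⟨k, rfl, rfl⟩ := hx
      rw [hφ']
      exact hp k
    | zero => simp
    | add x y _ _ hx hy => rw [map_add]; exact add_mem hx hy
    | smul c x _ hx => rw [map_smul]; exact Submodule.smul_mem _ c hx
  have split (u : A) : ∃ x₀ ∈ (ofTable p m g).part 0, ∃ x₁ ∈ (ofTable p m g).part 1,
      b.equivFun u = x₀ + x₁ := by
    have hu : b.equivFun u ∈ (ofTable p m g).part 0 ⊔ (ofTable p m g).part 1 := by
      rw [ofTable_isCompl.sup_eq_top]; trivial
    obtain ⟨x₀, h₀, x₁, h₁, hx⟩ := Submodule.mem_sup.1 hu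
    exact ⟨x₀, h₀, x₁, h₁, hx.symm⟩
  refine ⟨b.equivFun, fun i u => ⟨fun hu => by simpa using back i _ hu, fun hu => ?_⟩, ?_, ?_⟩
  · obtain ⟨x₀, h₀, x₁, h₁, hx⟩ := split u
    have hu' : u = b.equivFun.symm x₀ + b.equivFun.symm x₁ := by
      rw [← map_add, ← hx, LinearEquiv.symm_apply_apply]
    rcases zmod_two_eq_zero_or_one i with rfl | rfl
    · have : b.equivFun.symm x₁ = 0 := by
        refine hS.eq_zero_of_mem ?_ (back 1 _ h₁)
        simpa [hu'] using sub_mem hu (back 0 _ h₀)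
      rw [hx, (LinearEquiv.map_eq_zero_iff _).1 this]
      simpa using h₀
    · have : b.equivFun.symm x₀ = 0 := by
        refine hS.eq_zero_of_mem (back 0 _ h₀) ?_
        simpa [hu'] using sub_mem hu (back 1 _ h₁)
      rw [hx, (LinearEquiv.map_eq_zero_iff _).1 this]
      simpa using h₁
  · have : S.mul.compr₂ (b.equivFun : A →ₗ[K] (Fin 4 → K)) =
        (ofTable p m g).mul.compl₁₂ (b.equivFun : A →ₗ[K] (Fin 4 → K)) b.equivFun := by
      refine LinearMap.ext_basis b b fun i j => ?_
      simp only [LinearMap.compr₂_apply, LinearMap.compl₁₂_apply, LinearEquiv.coe_coe, hb, hm, hφ,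
        ofTable_mul_single, map_sum, map_smul]
      exact (pi_eq_sum_univ' _).symm
    exact fun u w => LinearMap.congr_fun₂ this u w
  · have : (ofTable p m g).form.compl₁₂ (b.equivFun : A →ₗ[K] (Fin 4 → K)) b.equivFun =
        S.form := by
      refine LinearMap.ext_basis b b fun i j => ?_
      simp only [LinearMap.compl₁₂_apply, LinearEquiv.coe_coe, hb, hφ, ofTable_form_single, hv i j]
    exact fun u w => LinearMap.congr_fun₂ this u w

end IsFrame

namespace IsPseudoEuclideanNovikov

/-- Fewer than four homogeneous vectors have a non-zero homogeneous vector orthogonal to them. -/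
theorem exists_orthogonal (h : S.IsPseudoEuclideanNovikov) (hA : Module.finrank K A = 4)
    (hf : S.FormIsEven ∨ S.FormIsOdd) {n : ℕ} (hn : n < 4) (v : Fin n → A)
    (hv : ∀ k, ∃ i, v k ∈ S.part i) :
    ∃ i, ∃ w ∈ S.part i, w ≠ 0 ∧ ∀ k, S.form (v k) w = 0 := by
  have : FiniteDimensional K A := Module.finite_of_finrank_pos (by omega)
  let f : A →ₗ[K] (Fin n → K) := LinearMap.pi fun k => S.form (v k)
  have hker : LinearMap.ker f ≠ ⊥ := LinearMap.ker_ne_bot_of_finrank_lt (by simp [hA, hn])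
  obtain ⟨w, hw, hw0⟩ := Submodule.exists_mem_ne_zero_of_ne_bot hker
  have hw (k : Fin n) : S.form (v k) w = 0 := congrFun (LinearMap.mem_ker.1 hw) k
  obtain ⟨w₀, h₀, w₁, h₁, rfl⟩ := h.exists_add w
  have hk (k : Fin n) : S.form (v k) w₀ = 0 ∧ S.form (v k) w₁ = 0 := by
    have hk := hw k
    rw [map_add] at hk
    obtain ⟨i, hi⟩ := hv k
    have : S.form (v k) w₀ = 0 ∨ S.form (v k) w₁ = 0 := by
      rcases hf with hf | hf <;> rcases zmod_two_eq_zero_or_one i with rfl | rfl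
      · exact Or.inr (hf 0 1 _ _ (by decide) hi h₁)
      · exact Or.inl (hf 1 0 _ _ (by decide) hi h₀)
      · exact Or.inl (hf 0 _ _ hi h₀)
      · exact Or.inr (hf 1 _ _ hi h₁)
    rcases this with h' | h' <;> simp_all
  by_cases hz : w₀ = 0
  · exact ⟨1, w₁, h₁, fun h' => hw0 (by simp [hz, h']), fun k => (hk k).2⟩
  · exact ⟨0, w₀, h₀, hz, fun k => (hk k).1⟩

end IsPseudoEuclideanNovikov

end StructureTheory

section OddClassification

variable {K A : Type*} [Field K] [AddCommGroup A] [Module K A]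
  {S : FormedSuperalgebra K A}

/-- The antidiagonal Gram matrix, shared by `A9` and all the odd models. -/
def splitGram (K : Type*) [Field K] : Matrix (Fin 4) (Fin 4) K :=
  !![0, 0, 0, 1; 0, 0, 1, 0; 0, 1, 0, 0; 1, 0, 0, 0]

theorem splitGram_mul_transpose : splitGram K * (splitGram K).transpose = 1 := by
  ext i j
  fin_cases i <;> fin_cases j <;> simp [splitGram, Matrix.mul_apply, Fin.sum_univ_four]

namespace IsPseudoEuclideanNovikov

theorem odd_form_comm (h : S.IsPseudoEuclideanNovikov) (ho : S.FormIsOdd) (u v : A) :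
    S.form u v = S.form v u := by
  revert u v
  refine h.homogeneous_induction (fun u v hu hv w => by simp [hu, hv]) fun i u hu => ?_
  refine h.homogeneous_induction (fun u v hu hv => by simp [hu, hv]) fun j v hv => ?_
  by_cases hij : i = j
  · subst hij
    rw [ho i u v hu hv, ho i v u hv hu]
  · rw [h.form_symm i j u v hu hv]
    rcases zmod_two_eq_zero_or_one i with rfl | rfl <;>
    rcases zmod_two_eq_zero_or_one j with rfl | rfl <;> simp_all

/-- A non-zero homogeneous vector has a dual partner of the opposite parity. -/
theorem odd_exists_dual (h : S.IsPseudoEuclideanNovikov) (ho : S.FormIsOdd) {i : ZMod 2} {x : A}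
    (hx : x ∈ S.part i) (hx0 : x ≠ 0) : ∃ y ∈ S.part (i + 1), S.form x y = 1 := by
  obtain ⟨z, hz⟩ := h.exists_form_ne_zero hx0
  rw [h.odd_form_comm ho] at hz
  have : ∃ y ∈ S.part (i + 1), S.form x y ≠ 0 := by
    obtain ⟨z₀, h₀, z₁, h₁, rfl⟩ := h.exists_add z
    rcases zmod_two_eq_zero_or_one i with rfl | rfl
    · exact ⟨z₁, h₁, by simpa [ho 0 x z₀ hx h₀] using hz⟩
    · exact ⟨z₀, h₀, by simpa [ho 1 x z₁ hx h₁] using hz⟩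
  obtain ⟨y, hy, hxy⟩ := this
  exact ⟨(S.form x y)⁻¹ • y, Submodule.smul_mem _ _ hy, by simp [hxy]⟩

/-- Two independent vectors of the same parity have a dual pair. -/
theorem odd_exists_dual_pair (h : S.IsPseudoEuclideanNovikov) (ho : S.FormIsOdd) {i : ZMod 2}
    {x y : A} (hx : x ∈ S.part i) (hy : y ∈ S.part i) (hx0 : x ≠ 0) (hxy : ∀ c : K, y ≠ c • x) :
    ∃ x' ∈ S.part (i + 1), ∃ y' ∈ S.part (i + 1),
      S.form x x' = 1 ∧ S.form y x' = 0 ∧ S.form x y' = 0 ∧ S.form y y' = 1 := by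
  obtain ⟨f, hf, hxf⟩ := h.odd_exists_dual ho hx hx0
  have hz : y - S.form y f • x ∈ S.part i := sub_mem hy (Submodule.smul_mem _ _ hx)
  obtain ⟨f', hf', hzf'⟩ := h.odd_exists_dual ho hz (sub_ne_zero.2 (hxy _))
  have hy' : f' - S.form x f' • f ∈ S.part (i + 1) := sub_mem hf' (Submodule.smul_mem _ _ hf)
  have hyy' : S.form y (f' - S.form x f' • f) = 1 := by
    simp at hzf' ⊢
    linear_combination hzf'
  refine ⟨f - S.form y f • (f' - S.form x f' • f), sub_mem hf (Submodule.smul_mem _ _ hy'),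
    f' - S.form x f' • f, hy', ?_, ?_, ?_, hyy'⟩
  · simp [hxf]
  · rw [map_sub, map_smul, hyy']
    simp
  · simp [hxf]

theorem oddFrame (h : S.IsPseudoEuclideanNovikov) (ho : S.FormIsOdd) {i : ZMod 2}
    {v : Fin 4 → A} (h0 : v 0 ∈ S.part i) (h1 : v 1 ∈ S.part i) (h2 : v 2 ∈ S.part (i + 1))
    (h3 : v 3 ∈ S.part (i + 1)) (h02 : S.form (v 0) (v 2) = 0) (h03 : S.form (v 0) (v 3) = 1)
    (h12 : S.form (v 1) (v 2) = 1) (h13 : S.form (v 1) (v 3) = 0) :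
    S.IsFrame (splitGram K) v := by
  simp only [IsFrame, Fin.forall_fin_succ]
  simp [splitGram, h02, h03, h12, h13, ho _ _ _ h0 h0, ho _ _ _ h0 h1, ho _ _ _ h1 h1,
    ho _ _ _ h1 h0, ho _ _ _ h2 h2, ho _ _ _ h2 h3, ho _ _ _ h3 h2, ho _ _ _ h3 h3,
    h.odd_form_comm ho (v 2), h.odd_form_comm ho (v 3) (v 0), h.odd_form_comm ho (v 3) (v 1)]

theorem exists_oddFrame (h : S.IsPseudoEuclideanNovikov) (ho : S.FormIsOdd)
    (hA : Module.finrank K A = 4) :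
    ∃ v : Fin 4 → A, v 0 ∈ S.part 0 ∧ v 1 ∈ S.part 0 ∧ v 2 ∈ S.part 1 ∧ v 3 ∈ S.part 1 ∧
      S.IsFrame (splitGram K) v := by
  have key : ∀ i, ∀ x ∈ S.part i, x ≠ 0 → ∃ y ∈ S.part 0, ∃ z ∈ S.part 1, S.form y z = 1 := by
    intro i x hx hx0
    obtain ⟨y, hy, hxy⟩ := h.odd_exists_dual ho hx hx0
    rcases zmod_two_eq_zero_or_one i with rfl | rfl
    · exact ⟨x, hx, y, by simpa using hy, hxy⟩
    · exact ⟨y, hy, x, hx, by rwa [h.odd_form_comm ho]⟩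
  obtain ⟨i, x, hx, hx0, -⟩ := h.exists_orthogonal hA (Or.inr ho) (n := 0) (by norm_num)
    (fun _ => 0) (fun k => k.elim0)
  obtain ⟨y, hy, z, hz, hyz⟩ := key i x hx hx0
  have hzy : S.form z y = 1 := by rwa [h.odd_form_comm ho]
  obtain ⟨j, w, hw, hw0, hwo⟩ := h.exists_orthogonal hA (Or.inr ho) (n := 2) (by norm_num)
    ![y, z] (by simpa [Fin.forall_fin_succ] using ⟨⟨0, hy⟩, ⟨1, hz⟩⟩)
  have hyw : S.form y w = 0 := hwo 0
  have hzw : S.form z w = 0 := hwo 1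
  obtain ⟨w', hw', hww'⟩ := h.odd_exists_dual ho hw hw0
  rcases zmod_two_eq_zero_or_one j with rfl | rfl
  · have hw' : w' ∈ S.part 1 := by simpa using hw'
    have hwz : S.form w z = 0 := by rwa [h.odd_form_comm ho]
    refine ⟨![y, w, w' - S.form y w' • z, z], hy, hw,
      sub_mem hw' (Submodule.smul_mem _ _ hz), hz, ?_⟩
    exact h.oddFrame ho (i := 0) hy hw (sub_mem hw' (Submodule.smul_mem _ _ hz)) hz
      (by simp [hyz]) (by simpa using hyz) (by simp [hww', hwz]) (by simpa using hwz)
  · have hw' : w' ∈ S.part 0 := hw'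
    have hw'w : S.form w' w = 1 := by rwa [h.odd_form_comm ho]
    refine ⟨![y, w' - S.form z w' • y, w, z], hy,
      sub_mem hw' (Submodule.smul_mem _ _ hy), hw, hz, ?_⟩
    exact h.oddFrame ho (i := 0) hy (sub_mem hw' (Submodule.smul_mem _ _ hy)) hw hz
      (by simpa using hyw) (by simpa using hyz) (by simp [hw'w, hyw])
      (by simp [hyz, h.odd_form_comm ho w' z])

end IsPseudoEuclideanNovikov

namespace IsFrame

variable {v : Fin 4 → A}

theorem split_eq_sum (hv : S.IsFrame (splitGram K) v) (hA : Module.finrank K A = 4) (x : A) :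
    x = S.form (v 3) x • v 0 + S.form (v 2) x • v 1 + S.form (v 1) x • v 2 +
      S.form (v 0) x • v 3 := by
  conv_lhs => rw [hv.eq_sum splitGram_mul_transpose hA x]
  simp [splitGram, Fin.sum_univ_four]

theorem split_eq_sum_of_mem_zero (hv : S.IsFrame (splitGram K) v) (hA : Module.finrank K A = 4)
    (ho : S.FormIsOdd) (h0 : v 0 ∈ S.part 0) (h1 : v 1 ∈ S.part 0) {x : A} (hx : x ∈ S.part 0) :
    x = S.form (v 3) x • v 0 + S.form (v 2) x • v 1 := by
  conv_lhs => rw [hv.split_eq_sum hA x, ho 0 _ _ h0 hx, ho 0 _ _ h1 hx]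
  simp

theorem split_eq_sum_of_mem_one (hv : S.IsFrame (splitGram K) v) (hA : Module.finrank K A = 4)
    (ho : S.FormIsOdd) (h2 : v 2 ∈ S.part 1) (h3 : v 3 ∈ S.part 1) {x : A} (hx : x ∈ S.part 1) :
    x = S.form (v 1) x • v 2 + S.form (v 0) x • v 3 := by
  conv_lhs => rw [hv.split_eq_sum hA x, ho 1 _ _ h2 hx, ho 1 _ _ h3 hx]
  simp

end IsFrame

namespace IsPseudoEuclideanNovikov

theorem odd_mul_even_eq_zero [CharZero K] (h : S.IsPseudoEuclideanNovikov) (ho : S.FormIsOdd)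
    (hA : Module.finrank K A = 4) {f y : A} (hf : f ∈ S.part 1) (hy : y ∈ S.part 0) :
    S.mul f y = 0 := by
  obtain ⟨v, h0, h1, h2, h3, hv⟩ := h.exists_oddFrame ho hA
  have m0 : S.mul f (v 0) ∈ S.part 1 := h.mul_mem' hf h0 rfl
  have m1 : S.mul f (v 1) ∈ S.part 1 := h.mul_mem' hf h1 rfl
  have skew (y z : A) (hy : y ∈ S.part 0) : S.form z (S.mul f y) = -S.form y (S.mul f z) := by
    rw [h.odd_form_comm ho, h.left_antisymm 1 0 f y z hf hy]
    simp
  have s00 : S.form (v 0) (S.mul f (v 0)) = 0 := self_eq_neg.1 (skew _ _ h0)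
  have s11 : S.form (v 1) (S.mul f (v 1)) = 0 := self_eq_neg.1 (skew _ _ h1)
  have e0 := hv.split_eq_sum_of_mem_one hA ho h2 h3 m0
  have e1 := hv.split_eq_sum_of_mem_one hA ho h2 h3 m1
  have s10 := skew (v 0) (v 1) h0
  by_cases hs : S.form (v 0) (S.mul f (v 1)) = 0
  · rw [s00, s10, hs] at e0
    rw [s11, hs] at e1
    rw [hv.split_eq_sum_of_mem_zero hA ho h0 h1 hy, map_add, map_smul, map_smul, e0, e1]
    simp
  · have z2 (w : A) : S.mul (v 2) w = 0 := by
      have := h.mul_mul_eq_zero f (v 0) w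
      rw [e0, s00, s10] at this
      simpa [hs] using this
    have z3 (w : A) : S.mul (v 3) w = 0 := by
      have := h.mul_mul_eq_zero f (v 1) w
      rw [e1, s11] at this
      simpa [hs] using this
    rw [hv.split_eq_sum_of_mem_one hA ho h2 h3 hf]
    simp [z2, z3]

end IsPseudoEuclideanNovikov

end OddClassification

section OddClassification

variable {K A : Type*} [Field K] [AddCommGroup A] [Module K A] {S : FormedSuperalgebra K A}

namespace IsPseudoEuclideanNovikov

theorem odd_left_symm_of_odd (h : S.IsPseudoEuclideanNovikov) (ho : S.FormIsOdd) {f g : A}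
    (hf : f ∈ S.part 1) (hg : g ∈ S.part 1) (w : A) :
    S.form w (S.mul f g) = S.form g (S.mul f w) := by
  rw [h.odd_form_comm ho w, h.left_antisymm 1 1 f g w hf hg]
  simp

theorem odd_left_antisymm_of_even (h : S.IsPseudoEuclideanNovikov) (ho : S.FormIsOdd) {u v : A}
    {i : ZMod 2} (hu : u ∈ S.part 0) (hv : v ∈ S.part i) (w : A) :
    S.form w (S.mul u v) = -S.form v (S.mul u w) := by
  rw [h.odd_form_comm ho w, h.left_antisymm 0 i u v w hu hv]
  simp

theorem odd_exists_model_of_frame [CharZero K] (h : S.IsPseudoEuclideanNovikov)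
    (ho : S.FormIsOdd) (hA : Module.finrank K A = 4) {v : Fin 4 → A} (h0 : v 0 ∈ S.part 0)
    (h1 : v 1 ∈ S.part 0) (h2 : v 2 ∈ S.part 1) (h3 : v 3 ∈ S.part 1)
    (hv : S.IsFrame (splitGram K) v) (z1 : ∀ w, S.mul (v 1) w = 0)
    (nz : ∃ w ∈ S.part 0, S.mul (v 0) w ≠ 0) :
    ∃ M : FormedSuperalgebra K (Fin 4 → K), OddModel M ∧ S.Isomorphic M := by
  obtain ⟨w, hw, hw0⟩ := nz
  have even (x y : A) (hxy : S.mul x y ∈ S.part 0) :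
      S.form (v 3) (S.mul x y) = 0 ∧ S.mul x y = S.form (v 2) (S.mul x y) • v 1 := by
    have e := hv.split_eq_sum_of_mem_zero hA ho h0 h1 hxy
    have hz := h.mul_mul_eq_zero x y w
    rw [e] at hz
    have hz : S.form (v 3) (S.mul x y) = 0 := by simpa [z1, hw0] using hz
    exact ⟨hz, by simpa [hz] using e⟩
  have d0 := (even _ _ (h.mul_mem' h0 h0 rfl)).2
  have d1 := (even _ _ (h.mul_mem' h0 h1 rfl)).2
  set α := S.form (v 2) (S.mul (v 0) (v 0))
  set a := S.form (v 2) (S.mul (v 0) (v 1))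
  have d2 : S.mul (v 0) (v 2) = -a • v 2 + -α • v 3 := by
    rw [hv.split_eq_sum_of_mem_one hA ho h2 h3 (h.mul_mem' h0 h2 rfl),
      h.odd_left_antisymm_of_even ho h0 h2, h.odd_left_antisymm_of_even ho h0 h2]
  have d3 : S.mul (v 0) (v 3) = 0 := by
    rw [hv.split_eq_sum_of_mem_one hA ho h2 h3 (h.mul_mem' h0 h3 rfl),
      h.odd_left_antisymm_of_even ho h0 h3, h.odd_left_antisymm_of_even ho h0 h3,
      (even _ _ (h.mul_mem' h0 h0 rfl)).1, (even _ _ (h.mul_mem' h0 h1 rfl)).1]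
    simp
  have o3 (f : A) (hf : f ∈ S.part 1) : S.mul f (v 3) = 0 := by
    rw [(even _ _ (h.mul_mem' hf h3 one_add_one_zmod_two)).2, h.odd_left_symm_of_odd ho hf h3,
      (even _ _ (h.mul_mem' hf h2 one_add_one_zmod_two)).1, zero_smul]
  have o2 (f : A) (hf : f ∈ S.part 1) := (even _ _ (h.mul_mem' hf h2 one_add_one_zmod_two)).2
  have o20 := h.odd_mul_even_eq_zero ho hA h2 h0
  have o21 := h.odd_mul_even_eq_zero ho hA h2 h1
  have o30 := h.odd_mul_even_eq_zero ho hA h3 h0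
  have o31 := h.odd_mul_even_eq_zero ho hA h3 h1
  have o23 := o3 _ h2
  have o33 := o3 _ h3
  have ne1 : v 1 ≠ 0 := (hv.linearIndependent splitGram_mul_transpose).ne_zero 1
  have aq (f : A) (hf : f ∈ S.part 1) : a * S.form (v 2) (S.mul f (v 2)) = 0 := by
    have hc := h.mul_left_supercomm h0 hf (v 2)
    rw [o2 f hf, d2, map_smul, d1, koszul_zero_left, one_smul, map_add, map_smul, map_smul,
      o3 f hf, smul_zero, add_zero, o2 f hf, smul_smul, smul_smul] at hc
    have hc := smul_left_injective K ne1 hc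
    have h21 : S.form (v 2) (v 1) = 1 := by simpa [splitGram] using hv 2 1
    rw [map_smul, h21, smul_eq_mul] at hc
    apply self_eq_neg.1
    linear_combination hc
  have q22 := o2 _ h2
  have q32 := o2 _ h3
  have hp : ∀ k, v k ∈ S.part ((![0, 0, 1, 1] : Fin 4 → ZMod 2) k) := by
    simp [Fin.forall_fin_succ, h0, h1, h2, h3]
  have model14 (hq2 : S.mul (v 2) (v 2) = 0) (hq3 : S.mul (v 3) (v 2) = 0) :
      ∃ M : FormedSuperalgebra K (Fin 4 → K), OddModel M ∧ S.Isomorphic M := by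
    refine ⟨_, .A14 a α, ?_⟩
    rw [A14, ofTable_eq_vecCons]
    refine hv.isomorphic_ofTable splitGram_mul_transpose hA h.toIsSuperalgebra hp ?_
    simp [Fin.forall_fin_succ, Fin.sum_univ_four, d0, d1, d2, d3, z1, o20, o21, o30, o31, o23, o33,
      hq2, hq3]
  by_cases ha : a = 0
  · have hα : α ≠ 0 := by
      intro hα
      apply hw0
      rw [hv.split_eq_sum_of_mem_zero hA ho h0 h1 hw, map_add, map_smul, map_smul, d0, d1, ha, hα]
      simp
    have hq3 : S.mul (v 3) (v 2) = 0 := by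
      have := h.mul_mul_eq_zero (v 0) (v 2) (v 2)
      rw [d2, ha] at this
      simpa [hα] using this
    by_cases hq2 : S.form (v 2) (S.mul (v 2) (v 2)) = 0
    · exact model14 (by rw [q22, hq2, zero_smul]) hq3
    refine ⟨_, .A18 (S.form (v 2) (S.mul (v 2) (v 2))) α hq2, ?_⟩
    rw [A18, ofTable_eq_vecCons]
    refine hv.isomorphic_ofTable splitGram_mul_transpose hA h.toIsSuperalgebra hp ?_
    rw [ha] at d1 d2
    simp [Fin.forall_fin_succ, Fin.sum_univ_four, d0, d1, d2, d3, z1, o20, o21, o30, o31, o23, o33,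
      hq3, ← q22]
  · refine model14 ?_ ?_
    · rw [q22, (mul_eq_zero.1 (aq _ h2)).resolve_left ha, zero_smul]
    · rw [q32, (mul_eq_zero.1 (aq _ h3)).resolve_left ha, zero_smul]

theorem odd_exists_model_of_even_mul_ne_zero [CharZero K] (h : S.IsPseudoEuclideanNovikov)
    (ho : S.FormIsOdd) (hA : Module.finrank K A = 4) {u w : A} (hu : u ∈ S.part 0)
    (hw : w ∈ S.part 0) (huw : S.mul u w ≠ 0) :
    ∃ M : FormedSuperalgebra K (Fin 4 → K), OddModel M ∧ S.Isomorphic M := by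
  have hx : S.mul u w ∈ S.part 0 := h.mul_mem' hu hw rfl
  have hxu (c : K) : u ≠ c • S.mul u w := by
    intro hc
    apply huw
    conv_lhs => rw [hc]
    simp [h.mul_mul_eq_zero]
  obtain ⟨f, hf, e, he, f1, f2, f3, f4⟩ := h.odd_exists_dual_pair ho hx hu huw hxu
  exact h.odd_exists_model_of_frame ho hA (v := ![u, S.mul u w, f, e]) hu hx
    (by simpa using hf) (by simpa using he) (h.oddFrame ho (i := 0) hu hx hf he f2 f4 f1 f3)
    (h.mul_mul_eq_zero u w) ⟨w, hw, huw⟩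

theorem exists_root_of_cubic [IsAlgClosed K] {a : K} (ha : a ≠ 0) (b c d : K) :
    ∃ t : K, a * t ^ 3 + b * t ^ 2 + c * t + d = 0 := by
  have hdeg := Polynomial.degree_cubic (b := b) (c := c) (d := d) ha
  obtain ⟨t, ht⟩ := IsAlgClosed.exists_root _ (ne_of_eq_of_ne hdeg (by norm_num))
  exact ⟨t, by simpa using ht⟩

/-- When the products of even vectors vanish, only the products of odd vectors remain, and these
are determined by the trilinear form `⟨u • v, w⟩` on the odd part. -/
theorem odd_exists_model_of_even_mul_eq_zero [IsAlgClosed K] [CharZero K]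
    (h : S.IsPseudoEuclideanNovikov) (ho : S.FormIsOdd) (hA : Module.finrank K A = 4)
    (hz : ∀ u ∈ S.part 0, ∀ w ∈ S.part 0, S.mul u w = 0) :
    ∃ M : FormedSuperalgebra K (Fin 4 → K), OddModel M ∧ S.Isomorphic M := by
  obtain ⟨x, h0, h1, h2, h3, hx⟩ := h.exists_oddFrame ho hA
  have hli := hx.linearIndependent splitGram_mul_transpose
  have hz1 (u f : A) (hu : u ∈ S.part 0) (hf : f ∈ S.part 1) : S.mul u f = 0 := by
    rw [hx.split_eq_sum_of_mem_one hA ho h2 h3 (h.mul_mem' hu hf (zero_add 1)),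
      h.odd_left_antisymm_of_even ho hu hf, h.odd_left_antisymm_of_even ho hu hf, hz u hu _ h0,
      hz u hu _ h1]
    simp
  have symm (f g k : A) (hf : f ∈ S.part 1) (hg : g ∈ S.part 1) :
      S.form k (S.mul f g) = S.form g (S.mul f k) := h.odd_left_symm_of_odd ho hf hg k
  have cubic : ∃ d ∈ S.part 1, d ≠ 0 ∧ S.form d (S.mul d d) = 0 := by
    by_cases ha : S.form (x 2) (S.mul (x 2) (x 2)) = 0
    · exact ⟨x 2, h2, hli.ne_zero 2, ha⟩
    obtain ⟨t, ht⟩ := exists_root_of_cubic ha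
      (S.form (x 2) (S.mul (x 2) (x 3)) + S.form (x 2) (S.mul (x 3) (x 2)) +
        S.form (x 3) (S.mul (x 2) (x 2)))
      (S.form (x 2) (S.mul (x 3) (x 3)) + S.form (x 3) (S.mul (x 2) (x 3)) +
        S.form (x 3) (S.mul (x 3) (x 2)))
      (S.form (x 3) (S.mul (x 3) (x 3)))
    refine ⟨t • x 2 + x 3, add_mem (Submodule.smul_mem _ _ h2) h3, fun h' => ?_, ?_⟩
    · have := congrArg (S.form (x 0)) h'
      simp [hx _ _, splitGram] at this
    · simp only [map_add, map_smul, LinearMap.add_apply, LinearMap.smul_apply, smul_eq_mul]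
      linear_combination ht
  have model (f d : A) (hf : f ∈ S.part 1) (hd : d ∈ S.part 1) (hf0 : f ≠ 0)
      (hfd : ∀ c : K, d ≠ c • f) : ∃ v : Fin 4 → A, v 2 = f ∧ v 3 = d ∧ v 0 ∈ S.part 0 ∧
        v 1 ∈ S.part 0 ∧ S.IsFrame (splitGram K) v := by
    obtain ⟨e₁, he₁, e, he, k1, k2, k3, k4⟩ := h.odd_exists_dual_pair ho hf hd hf0 hfd
    rw [h.odd_form_comm ho] at k1 k2 k3 k4
    exact ⟨![e, e₁, f, d], rfl, rfl, he, he₁,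
      h.oddFrame ho (i := 0) he he₁ hf hd k3 k4 k1 k2⟩
  have table (v : Fin 4 → A) (h0 : v 0 ∈ S.part 0) (h1 : v 1 ∈ S.part 0) (h2 : v 2 ∈ S.part 1)
      (h3 : v 3 ∈ S.part 1) (hv : S.IsFrame (splitGram K) v)
      (hd : S.form (v 3) (S.mul (v 3) (v 3)) = 0) :
      S.Isomorphic (A19 (S.form (v 2) (S.mul (v 2) (v 2))) (S.form (v 3) (S.mul (v 2) (v 3)))
        (S.form (v 2) (S.mul (v 3) (v 3))) (S.form (v 3) (S.mul (v 2) (v 2)))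
        (S.form (v 2) (S.mul (v 3) (v 2)))) := by
    rw [A19, ofTable_eq_vecCons]
    refine hv.isomorphic_ofTable splitGram_mul_transpose hA h.toIsSuperalgebra
      (by simp [Fin.forall_fin_succ, h0, h1, h2, h3]) ?_
    have expand (f g : A) (hf : f ∈ S.part 1) (hg : g ∈ S.part 1) :=
      hv.split_eq_sum_of_mem_zero hA ho h0 h1 (h.mul_mem' hf hg one_add_one_zmod_two)
    have e22 := expand _ _ h2 h2
    have e23 := expand _ _ h2 h3
    have e32 := expand _ _ h3 h2
    have e33 := expand _ _ h3 h3
    rw [symm _ _ (v 2) h2 h3] at e23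
    rw [symm _ _ (v 3) h3 h2] at e32
    rw [hd] at e33
    simp [Fin.forall_fin_succ, Fin.sum_univ_four, hz _ h0 _ h0, hz _ h0 _ h1, hz _ h1 _ h0,
      hz _ h1 _ h1, hz1 _ _ h0 h2, hz1 _ _ h0 h3, hz1 _ _ h1 h2, hz1 _ _ h1 h3,
      h.odd_mul_even_eq_zero ho hA h2 h0, h.odd_mul_even_eq_zero ho hA h2 h1,
      h.odd_mul_even_eq_zero ho hA h3 h0, h.odd_mul_even_eq_zero ho hA h3 h1]
    exact ⟨⟨e22, e23⟩, e32, by simpa using e33⟩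
  by_cases hT : ∃ f ∈ S.part 1, S.form f (S.mul f f) ≠ 0
  · obtain ⟨f, hf, hff⟩ := hT
    obtain ⟨d, hd, hd0, hdd⟩ := cubic
    obtain ⟨v, rfl, rfl, k0, k1, hv⟩ := model f d hf hd (by rintro rfl; simp at hff) (by
      rintro c rfl
      simp [hff] at hdd
      simp [hdd] at hd0)
    exact ⟨_, .A19 _ _ _ _ _ hff, table v k0 k1 hf hd hv hdd⟩
  · push Not at hT
    have polar (f g : A) (hf : f ∈ S.part 1) (hg : g ∈ S.part 1) :
        S.form f (S.mul g f) = -(2 * S.form g (S.mul f f)) := by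
      have e1 := hT _ (add_mem hf hg)
      have e2 := hT _ (sub_mem hf hg)
      have e3 := symm f g f hf hg
      simp only [map_add, map_sub, LinearMap.add_apply, LinearMap.sub_apply, hT f hf, hT g hg]
        at e1 e2
      have h2 : (2 : K) ≠ 0 := two_ne_zero
      apply mul_left_cancel₀ h2
      linear_combination e1 - e2 - 2 * e3
    have key : ∃ f ∈ S.part 1, ∃ d ∈ S.part 1, f ≠ 0 ∧ (∀ c : K, d ≠ c • f) ∧
        S.form d (S.mul f f) = 0 := by
      by_cases hp : S.form (x 3) (S.mul (x 2) (x 2)) = 0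
      · refine ⟨x 2, h2, x 3, h3, hli.ne_zero 2, fun c hc => ?_, hp⟩
        have := congrArg (S.form (x 0)) hc
        simp [hx _ _, splitGram] at this
      · refine ⟨S.form (x 2) (S.mul (x 3) (x 3)) • x 2 + S.form (x 3) (S.mul (x 2) (x 2)) • x 3,
          add_mem (Submodule.smul_mem _ _ h2) (Submodule.smul_mem _ _ h3), x 2, h2, fun h' => ?_,
          fun c hc => ?_, ?_⟩
        · have := congrArg (S.form (x 0)) h'
          simp [hx _ _, splitGram, hp] at this
        · have e0 := congrArg (S.form (x 0)) hc
          have e1 := congrArg (S.form (x 1)) hc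
          simp [hx _ _, splitGram, hp] at e0 e1
          simp [e0] at e1
        · have e1 := polar _ _ h2 h3
          have e2 := symm _ _ (x 2) h2 h3
          simp only [map_add, map_smul, LinearMap.add_apply, LinearMap.smul_apply, smul_eq_mul,
            hT _ h2, e1, e2]
          ring
    obtain ⟨f, hf, d, hd, hf0, hfd, hffd⟩ := key
    obtain ⟨v, rfl, rfl, k0, k1, hv⟩ := model f d hf hd hf0 hfd
    refine ⟨_, .A15 (S.form (v 2) (S.mul (v 3) (v 3))) (S.form (v 3) (S.mul (v 2) (v 3))), ?_⟩
    have := table v k0 k1 hf hd hv (hT _ hd)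
    rw [hT _ hf, hffd, polar _ _ hf hd, hffd] at this
    convert this using 1
    rw [A15, A19]
    conv_lhs => rw [ofTable_eq_vecCons]
    conv_rhs => rw [ofTable_eq_vecCons]
    have : (![0, 0, 0, 0] : Fin 4 → K) = 0 := by simp
    simp [this]

theorem odd_exists_model [IsAlgClosed K] [CharZero K] (h : S.IsPseudoEuclideanNovikov)
    (ho : S.FormIsOdd) (hA : Module.finrank K A = 4) :
    ∃ M : FormedSuperalgebra K (Fin 4 → K), OddModel M ∧ S.Isomorphic M := by
  by_cases hz : ∀ u ∈ S.part 0, ∀ w ∈ S.part 0, S.mul u w = 0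
  · exact h.odd_exists_model_of_even_mul_eq_zero ho hA hz
  · push Not at hz
    obtain ⟨u, hu, w, hw, huw⟩ := hz
    exact h.odd_exists_model_of_even_mul_ne_zero ho hA hu hw huw

end IsPseudoEuclideanNovikov

end OddClassification

section EvenClassification

variable {K A : Type*} [Field K] [AddCommGroup A] [Module K A] {S : FormedSuperalgebra K A}

namespace IsPseudoEuclideanNovikov

theorem form_comm_of_even (h : S.IsPseudoEuclideanNovikov) {u : A} (hu : u ∈ S.part 0) (v : A) :
    S.form u v = S.form v u := by
  revert v
  refine h.homogeneous_induction (fun v w hv hw => by simp [hv, hw]) fun j v hv => ?_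
  rw [h.form_symm 0 j u v hu hv]
  simp

theorem even_exists_form_ne_zero (h : S.IsPseudoEuclideanNovikov) (he : S.FormIsEven)
    {i : ZMod 2} {x : A} (hx : x ∈ S.part i) (hx0 : x ≠ 0) :
    ∃ y ∈ S.part i, S.form x y = 1 := by
  have : ∃ y ∈ S.part i, S.form x y ≠ 0 := by
    by_contra! hc
    refine hx0 (h.eq_zero_of_form_right hx fun j v hv => ?_)
    by_cases hij : i = j
    · exact hc v (hij ▸ hv)
    · exact he i j x v hij hx hv
  obtain ⟨y, hy, hxy⟩ := this
  exact ⟨(S.form x y)⁻¹ • y, Submodule.smul_mem _ _ hy, by simp [hxy]⟩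

theorem even_exists_hyperbolic [CharZero K] (h : S.IsPseudoEuclideanNovikov) (he : S.FormIsEven)
    {i : ZMod 2} {x : A} (hx : x ∈ S.part i) (hx0 : x ≠ 0) (hxx : S.form x x = 0) :
    ∃ y ∈ S.part i, S.form x y = 1 ∧ S.form y y = 0 := by
  obtain ⟨y, hy, hxy⟩ := h.even_exists_form_ne_zero he hx hx0
  rcases zmod_two_eq_zero_or_one i with rfl | rfl
  · have hyx : S.form y x = 1 := by rwa [h.form_comm_of_even hy]
    refine ⟨y - (S.form y y / 2) • x, sub_mem hy (Submodule.smul_mem _ _ hx), ?_, ?_⟩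
    · simp [hxx, hxy]
    · simp [hxx, hxy, hyx]
      ring
  · exact ⟨y, hy, hxy, self_eq_neg.1 (by simpa using h.form_symm 1 1 y y hy hy)⟩

/-- A degenerate product space has a non-zero homogeneous isotropic vector, annihilated by the
product on both sides. -/
theorem even_exists_radical [CharZero K] (h : S.IsPseudoEuclideanNovikov) (he : S.FormIsEven)
    (hd : S.SquareDegenerate) : ∃ i, ∃ x ∈ S.part i, x ≠ 0 ∧ x ∈ S.square ∧ S.form x x = 0 ∧
      (∀ w, S.mul x w = 0) ∧ ∀ u, S.mul u x = 0 := by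
  have components : ∀ x ∈ S.square, ∃ x₀ ∈ S.square ⊓ S.part 0, ∃ x₁ ∈ S.square ⊓ S.part 1,
      x = x₀ + x₁ := by
    intro x hx
    induction hx using Submodule.span_induction with
    | mem x hx =>
      obtain ⟨u, v, rfl⟩ := hx
      obtain ⟨u₀, hu₀, u₁, hu₁, rfl⟩ := h.exists_add u
      obtain ⟨v₀, hv₀, v₁, hv₁, rfl⟩ := h.exists_add v
      have hsq (u v : A) : S.mul u v ∈ S.square := Submodule.subset_span ⟨u, v, rfl⟩
      refine ⟨S.mul u₀ v₀ + S.mul u₁ v₁, add_mem ⟨hsq _ _, h.mul_mem' hu₀ hv₀ rfl⟩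
        ⟨hsq _ _, h.mul_mem' hu₁ hv₁ rfl⟩, S.mul u₀ v₁ + S.mul u₁ v₀,
        add_mem ⟨hsq _ _, h.mul_mem' hu₀ hv₁ rfl⟩ ⟨hsq _ _, h.mul_mem' hu₁ hv₀ rfl⟩, ?_⟩
      simp only [map_add, LinearMap.add_apply]
      abel
    | zero => exact ⟨0, zero_mem _, 0, zero_mem _, by simp⟩
    | add x y _ _ hx hy =>
      obtain ⟨x₀, hx₀, x₁, hx₁, rfl⟩ := hx
      obtain ⟨y₀, hy₀, y₁, hy₁, rfl⟩ := hy
      exact ⟨x₀ + y₀, add_mem hx₀ hy₀, x₁ + y₁, add_mem hx₁ hy₁, by abel⟩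
    | smul c x _ hx =>
      obtain ⟨x₀, hx₀, x₁, hx₁, rfl⟩ := hx
      exact ⟨c • x₀, Submodule.smul_mem _ _ hx₀, c • x₁, Submodule.smul_mem _ _ hx₁, by simp⟩
  have finish : ∀ i, ∀ x ∈ S.part i, x ≠ 0 → x ∈ S.square → (∀ y ∈ S.square, S.form y x = 0) →
      ∃ i, ∃ x ∈ S.part i, x ≠ 0 ∧ x ∈ S.square ∧ S.form x x = 0 ∧
        (∀ w, S.mul x w = 0) ∧ ∀ u, S.mul u x = 0 := fun i x hx hx0 hxs ho =>
    ⟨i, x, hx, hx0, hxs, ho x hxs, h.mul_eq_zero_of_mem_square hxs,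
      h.mul_eq_zero_of_orthogonal ho⟩
  obtain ⟨x, hx, hx0, ho⟩ := hd
  obtain ⟨x₀, ⟨hs₀, h₀⟩, x₁, ⟨hs₁, h₁⟩, rfl⟩ := components x hx
  have orth (y : A) (hy : y ∈ S.square) : S.form y x₀ = 0 ∧ S.form y x₁ = 0 := by
    obtain ⟨y₀, ⟨ht₀, k₀⟩, y₁, ⟨ht₁, k₁⟩, rfl⟩ := components y hy
    have e0 := ho y₀ ht₀
    have e1 := ho y₁ ht₁
    have c01 := he 0 1 y₀ x₁ (by decide) k₀ h₁
    have c10 := he 1 0 y₁ x₀ (by decide) k₁ h₀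
    simp only [map_add, c01, c10, add_zero, zero_add] at e0 e1
    simp [e0, e1, c01, c10]
  by_cases hz : x₀ = 0
  · exact finish 1 x₁ h₁ (by simpa [hz] using hx0) hs₁ fun y hy => (orth y hy).2
  · exact finish 0 x₀ h₀ hz hs₀ fun y hy => (orth y hy).1

/-- In dimension four, a non-zero vector orthogonal to a hyperbolic pair and a unit vector is not
isotropic. -/
theorem form_self_ne_zero_of_orthogonal (h : S.IsPseudoEuclideanNovikov)
    (hA : Module.finrank K A = 4) {e d b w : A} (ee : S.form e e = 0) (ed : S.form e d = 1)
    (de : S.form d e ≠ 0) (dd : S.form d d = 0) (eb : S.form e b = 0) (db : S.form d b = 0)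
    (bb : S.form b b = 1) (ew : S.form e w = 0) (dw : S.form d w = 0) (bw : S.form b w = 0)
    (hw : w ≠ 0) : S.form w w ≠ 0 := by
  intro ww
  have hli : LinearIndependent K ![e, d, b, w] := by
    rw [Fintype.linearIndependent_iff]
    intro c hc
    simp only [Fin.sum_univ_four, Matrix.cons_val] at hc
    have c1 := congrArg (S.form e) hc
    simp [ee, ed, eb, ew] at c1
    have c0 := congrArg (S.form d) hc
    simp [dd, de, db, dw] at c0
    have c2 := congrArg (S.form b) hc
    simp [c0, c1, bb, bw] at c2
    simp [c0, c1, c2, hw] at hc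
    simp [Fin.forall_fin_succ, c0, c1, c2, hc]
  have hspan := hli.span_eq_top_of_card_eq_finrank (by simp [hA])
  refine hw (h.form_nondegenerate w fun u => ?_)
  have hu : u ∈ Submodule.span K (Set.range ![e, d, b, w]) := hspan ▸ Submodule.mem_top
  obtain ⟨c, rfl⟩ := (Submodule.mem_span_range_iff_exists_fun K).1 hu
  simp [Fin.sum_univ_four, ew, dw, bw, ww]

theorem exists_smul_form_self_eq_one [IsAlgClosed K] (S : FormedSuperalgebra K A) {y : A}
    (hy : S.form y y ≠ 0) : ∃ c : K, S.form (c • y) (c • y) = 1 := by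
  obtain ⟨r, hr⟩ := IsAlgClosed.exists_eq_mul_self (S.form y y)
  have hr0 : r ≠ 0 := by rintro rfl; simp [hr] at hy
  refine ⟨r⁻¹, ?_⟩
  simp [hr]
  field_simp

theorem even_exists_orthonormal_pair [IsAlgClosed K] [CharZero K]
    (h : S.IsPseudoEuclideanNovikov) (he : S.FormIsEven) (hA : Module.finrank K A = 4)
    {i : ZMod 2} {e d x : A} (hei : e ∈ S.part i) (hdi : d ∈ S.part i) (ee : S.form e e = 0)
    (ed : S.form e d = 1) (dd : S.form d d = 0) (hx : x ∈ S.part 0) (hx0 : x ≠ 0)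
    (ex : S.form e x = 0) (dx : S.form d x = 0) :
    ∃ b₁ ∈ S.part 0, ∃ b₂ ∈ S.part 0, S.form b₁ b₁ = 1 ∧ S.form b₂ b₂ = 1 ∧ S.form b₁ b₂ = 0 ∧
      S.form e b₁ = 0 ∧ S.form d b₁ = 0 ∧ S.form e b₂ = 0 ∧ S.form d b₂ = 0 := by
  have de : S.form d e ≠ 0 := by
    intro h0
    rw [h.form_symm i i e d hei hdi, h0] at ed
    simp at ed
  have unit : ∃ y ∈ S.part 0, S.form y y ≠ 0 ∧ S.form e y = 0 ∧ S.form d y = 0 := by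
    by_cases hxx : S.form x x = 0
    · obtain ⟨z, hz, hxz, hzz⟩ := h.even_exists_hyperbolic he hx hx0 hxx
      have xe : S.form x e = 0 := by rwa [h.form_comm_of_even hx]
      have xd : S.form x d = 0 := by rwa [h.form_comm_of_even hx]
      have : ∃ y ∈ S.part 0, S.form x y = 1 ∧ S.form e y = 0 ∧ S.form d y = 0 := by
        rcases zmod_two_eq_zero_or_one i with rfl | rfl
        · refine ⟨z - S.form e z • d - (S.form d z / S.form d e) • e,
            sub_mem (sub_mem hz (Submodule.smul_mem _ _ hdi)) (Submodule.smul_mem _ _ hei),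
            ?_, ?_, ?_⟩
          · simp [hxz, xe, xd]
          · simp [ed, ee]
          · simp [dd, de]
        · exact ⟨z, hz, hxz, he 1 0 _ _ (by decide) hei hz, he 1 0 _ _ (by decide) hdi hz⟩
      obtain ⟨y, hy, hxy, ey, dy⟩ := this
      by_cases hyy : S.form y y = 0
      · have hyx : S.form y x = 1 := by rwa [h.form_comm_of_even hy]
        exact ⟨x + y, add_mem hx hy, by simp [hxx, hyy, hxy, hyx, one_add_one_eq_two],
          by simp [ex, ey], by simp [dx, dy]⟩
      · exact ⟨y, hy, hyy, ey, dy⟩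
    · exact ⟨x, hx, hxx, ex, dx⟩
  obtain ⟨y, hy, hyy, ey, dy⟩ := unit
  obtain ⟨c, hc⟩ := exists_smul_form_self_eq_one S hyy
  have hb : c • y ∈ S.part 0 := Submodule.smul_mem _ _ hy
  have eb : S.form e (c • y) = 0 := by simp [ey]
  have db : S.form d (c • y) = 0 := by simp [dy]
  generalize c • y = b at hb hc eb db
  obtain ⟨j, w, hw, hw0, hwo⟩ := h.exists_orthogonal hA (Or.inl he) (n := 3) (by norm_num)
    ![e, d, b] (by simpa [Fin.forall_fin_succ] using ⟨⟨i, hei⟩, ⟨i, hdi⟩, ⟨0, hb⟩⟩)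
  have ew : S.form e w = 0 := hwo 0
  have dw : S.form d w = 0 := hwo 1
  have bw : S.form b w = 0 := hwo 2
  have hww := h.form_self_ne_zero_of_orthogonal hA ee ed de dd eb db hc ew dw bw hw0
  have hw' : w ∈ S.part 0 := by
    rcases zmod_two_eq_zero_or_one j with rfl | rfl
    · exact hw
    · exact absurd (self_eq_neg.1 (by simpa using h.form_symm 1 1 w w hw hw)) hww
  obtain ⟨c', hc'⟩ := exists_smul_form_self_eq_one S hww
  exact ⟨b, hb, c' • w, Submodule.smul_mem _ _ hw', hc, hc', by simp [bw], eb, db, by simp [ew],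
    by simp [dw]⟩

theorem left_antisymm_of_even (h : S.IsPseudoEuclideanNovikov) {u : A}
    (hu : u ∈ S.part 0) (v w : A) : S.form (S.mul u v) w = -S.form v (S.mul u w) := by
  revert v
  refine h.homogeneous_induction (fun v w hv hw => by simp [hv, hw, add_comm]) fun j v hv => ?_
  simpa using h.left_antisymm 0 j u v w hu hv

end IsPseudoEuclideanNovikov

end EvenClassification

section AllEvenClassification

variable {K A : Type*} [Field K] [AddCommGroup A] [Module K A] {S : FormedSuperalgebra K A}

/-- The Gram matrix of a hyperbolic pair and two unit vectors. -/
def unitGram (K : Type*) [Field K] : Matrix (Fin 4) (Fin 4) K :=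
  !![0, 0, 0, 1; 0, 1, 0, 0; 0, 0, 1, 0; 1, 0, 0, 0]

theorem unitGram_mul_transpose : unitGram K * (unitGram K).transpose = 1 := by
  ext i j
  fin_cases i <;> fin_cases j <;> simp [unitGram, Matrix.mul_apply, Fin.sum_univ_four]

theorem IsFrame.unit_eq_sum {v : Fin 4 → A} (hv : S.IsFrame (unitGram K) v)
    (hA : Module.finrank K A = 4) (x : A) :
    x = S.form (v 3) x • v 0 + S.form (v 1) x • v 1 + S.form (v 2) x • v 2 +
      S.form (v 0) x • v 3 := by
  conv_lhs => rw [hv.eq_sum unitGram_mul_transpose hA x]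
  simp [unitGram, Fin.sum_univ_four]

namespace IsPseudoEuclideanNovikov

theorem form_mul_skew (h : S.IsPseudoEuclideanNovikov) (hev : ∀ u, u ∈ S.part 0) (u v w : A) :
    S.form w (S.mul u v) = -S.form v (S.mul u w) := by
  rw [h.form_comm_of_even (hev w), h.left_antisymm_of_even (hev u)]

theorem form_mul_self [CharZero K] (h : S.IsPseudoEuclideanNovikov) (hev : ∀ u, u ∈ S.part 0)
    (u v : A) : S.form v (S.mul u v) = 0 :=
  self_eq_neg.1 (h.form_mul_skew hev u v v)

theorem exists_A7_of_frame [CharZero K] (h : S.IsPseudoEuclideanNovikov)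
    (hA : Module.finrank K A = 4) (hev : ∀ u, u ∈ S.part 0) {v : Fin 4 → A}
    (hv : S.IsFrame (unitGram K) v) (z0 : ∀ w, S.mul (v 0) w = 0) (r0 : ∀ u, S.mul u (v 0) = 0)
    (z1 : ∀ w, S.mul (v 1) w = 0) (z2 : ∀ w, S.mul (v 2) w = 0) :
    ∃ M : FormedSuperalgebra K (Fin 4 → K), EvenModel M ∧ S.Isomorphic M := by
  refine ⟨_, .A7 (S.form (v 1) (S.mul (v 3) (v 2))) (S.form (v 1) (S.mul (v 3) (v 3)))
    (S.form (v 2) (S.mul (v 3) (v 3))) 1 (Or.inl rfl), ?_⟩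
  rw [A7, ofTable_eq_vecCons]
  refine hv.isomorphic_ofTable unitGram_mul_transpose hA h.toIsSuperalgebra
    (by simp [Fin.forall_fin_succ, hev]) ?_
  have f0 (w : A) : S.form (v 0) (S.mul (v 3) w) = 0 := by simp [h.form_mul_skew hev _ w, r0]
  have e1 := hv.unit_eq_sum hA (S.mul (v 3) (v 1))
  have e2 := hv.unit_eq_sum hA (S.mul (v 3) (v 2))
  have e3 := hv.unit_eq_sum hA (S.mul (v 3) (v 3))
  rw [f0, h.form_mul_self hev, h.form_mul_skew hev _ (v 1) (v 3),
    h.form_mul_skew hev _ (v 1) (v 2)] at e1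
  rw [f0, h.form_mul_self hev, h.form_mul_skew hev _ (v 2) (v 3)] at e2
  rw [f0, h.form_mul_self hev] at e3
  simp [Fin.forall_fin_succ, Fin.sum_univ_four, z0, r0, z1, z2]
  exact ⟨by simpa using e1, by simpa using e2, by simpa using e3⟩

theorem exists_A8_of_frame [CharZero K] (h : S.IsPseudoEuclideanNovikov)
    (hA : Module.finrank K A = 4) (hev : ∀ u, u ∈ S.part 0) {v : Fin 4 → A}
    (hv : S.IsFrame (unitGram K) v) (z0 : ∀ w, S.mul (v 0) w = 0) (r0 : ∀ u, S.mul u (v 0) = 0)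
    (z1 : ∀ w, S.mul (v 1) w = 0) (h12 : ∀ u, S.form (v 1) (S.mul u (v 2)) = 0)
    (nz : ∃ u w, S.form (v 0) u = 0 ∧ S.mul u w ≠ 0) :
    ∃ M : FormedSuperalgebra K (Fin 4 → K), EvenModel M ∧ S.Isomorphic M := by
  have nz2 : ∃ w, S.mul (v 2) w ≠ 0 := by
    obtain ⟨u, w, hu, huw⟩ := nz
    refine ⟨w, fun h2 => huw ?_⟩
    rw [hv.unit_eq_sum hA u, hu]
    simp [z0, z1, h2]
  have f0 (u w : A) : S.form (v 0) (S.mul u w) = 0 := by simp [h.form_mul_skew hev _ w, r0]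
  have e3 (u : A) : S.mul u (v 3) = S.form (v 1) (S.mul u (v 3)) • v 1 := by
    have e := hv.unit_eq_sum hA (S.mul u (v 3))
    rw [f0, h.form_mul_self hev] at e
    obtain ⟨w, hw⟩ := nz2
    have hz := h.mul_mul_eq_zero u (v 3) w
    rw [e] at hz
    have hz : S.form (v 2) (S.mul u (v 3)) = 0 := by simpa [z1, hw] using hz
    simpa [hz] using e
  have h2 (u : A) : S.mul u (v 2) = 0 := by
    have h23 : S.form (v 2) (v 1) = 0 := by simpa [unitGram] using hv 2 1
    rw [hv.unit_eq_sum hA (S.mul u (v 2)), f0, h.form_mul_self hev, h12,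
      h.form_mul_skew hev _ (v 2) (v 3), e3]
    simp [h23]
  have e1 (u : A) : S.mul u (v 1) = -S.form (v 1) (S.mul u (v 3)) • v 0 := by
    rw [hv.unit_eq_sum hA (S.mul u (v 1)), f0, h.form_mul_self hev,
      h.form_mul_skew hev _ (v 1) (v 2), h.form_mul_skew hev _ (v 1) (v 3), h12]
    simp
  have ha : S.form (v 1) (S.mul (v 2) (v 3)) ≠ 0 := by
    intro ha
    obtain ⟨w, hw⟩ := nz2
    apply hw
    rw [hv.unit_eq_sum hA w]
    have h23 : S.mul (v 2) (v 3) = 0 := by rw [e3, ha, zero_smul]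
    simp [r0, h2, e1, h23]
  refine ⟨_, .A8 _ (S.form (v 1) (S.mul (v 3) (v 3))) 1 1 ha (Or.inl rfl) (Or.inl rfl), ?_⟩
  rw [A8, ofTable_eq_vecCons]
  refine hv.isomorphic_ofTable unitGram_mul_transpose hA h.toIsSuperalgebra
    (by simp [Fin.forall_fin_succ, hev]) ?_
  simp [Fin.forall_fin_succ, Fin.sum_univ_four, z0, r0, z1, h2, e1, ← e3]

theorem exists_A9_of_frame [CharZero K] (h : S.IsPseudoEuclideanNovikov)
    (hA : Module.finrank K A = 4) (hev : ∀ u, u ∈ S.part 0) {v : Fin 4 → A}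
    (hv : S.IsFrame (splitGram K) v) (z0 : ∀ w, S.mul (v 0) w = 0) (r0 : ∀ u, S.mul u (v 0) = 0)
    (z1 : ∀ w, S.mul (v 1) w = 0) (h12 : ∀ u, S.form (v 1) (S.mul u (v 2)) = 0)
    (nz : ∃ u w, S.form (v 0) u = 0 ∧ S.mul u w ≠ 0) :
    ∃ M : FormedSuperalgebra K (Fin 4 → K), EvenModel M ∧ S.Isomorphic M := by
  have nz2 : ∃ w, S.mul (v 2) w ≠ 0 := by
    obtain ⟨u, w, hu, huw⟩ := nz
    refine ⟨w, fun h2 => huw ?_⟩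
    rw [hv.split_eq_sum hA u, hu]
    simp [z0, z1, h2]
  have f0 (u w : A) : S.form (v 0) (S.mul u w) = 0 := by simp [h.form_mul_skew hev _ w, r0]
  have e3 (u : A) : S.mul u (v 3) = S.form (v 2) (S.mul u (v 3)) • v 1 := by
    have e := hv.split_eq_sum hA (S.mul u (v 3))
    rw [f0, h.form_mul_self hev] at e
    obtain ⟨w, hw⟩ := nz2
    have hz := h.mul_mul_eq_zero u (v 3) w
    rw [e] at hz
    have hz : S.form (v 1) (S.mul u (v 3)) = 0 := by simpa [z1, hw] using hz
    simpa [hz] using e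
  have h1 (u : A) : S.mul u (v 1) = 0 := by
    have h11 : S.form (v 1) (v 1) = 0 := by simpa [splitGram] using hv 1 1
    rw [hv.split_eq_sum hA (S.mul u (v 1)), f0, h.form_mul_self hev,
      h.form_mul_skew hev _ (v 1) (v 2), h12, h.form_mul_skew hev _ (v 1) (v 3), e3]
    simp [h11]
  have e2 (u : A) : S.mul u (v 2) = -S.form (v 2) (S.mul u (v 3)) • v 0 := by
    rw [hv.split_eq_sum hA (S.mul u (v 2)), f0, h.form_mul_self hev, h12,
      h.form_mul_skew hev _ (v 2) (v 3)]
    simp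
  have ha : S.form (v 2) (S.mul (v 2) (v 3)) ≠ 0 := by
    intro ha
    obtain ⟨w, hw⟩ := nz2
    apply hw
    rw [hv.split_eq_sum hA w]
    have h23 : S.mul (v 2) (v 3) = 0 := by rw [e3, ha, zero_smul]
    simp [r0, h1, e2, h23]
  refine ⟨_, .A9 _ (S.form (v 2) (S.mul (v 3) (v 3))) ha, ?_⟩
  rw [A9, ofTable_eq_vecCons]
  refine hv.isomorphic_ofTable splitGram_mul_transpose hA h.toIsSuperalgebra
    (by simp [Fin.forall_fin_succ, hev]) ?_
  simp [Fin.forall_fin_succ, Fin.sum_univ_four, z0, r0, z1, h1, e2, ← e3]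

theorem even_exists_model_of_forall_even [IsAlgClosed K] [CharZero K]
    (h : S.IsPseudoEuclideanNovikov) (hA : Module.finrank K A = 4) (hev : ∀ u, u ∈ S.part 0)
    {v : Fin 4 → A} (hv : S.IsFrame (unitGram K) v) (z0 : ∀ w, S.mul (v 0) w = 0)
    (r0 : ∀ u, S.mul u (v 0) = 0) :
    ∃ M : FormedSuperalgebra K (Fin 4 → K), EvenModel M ∧ S.Isomorphic M := by
  by_cases hz : (∀ w, S.mul (v 1) w = 0) ∧ ∀ w, S.mul (v 2) w = 0
  · exact h.exists_A7_of_frame hA hev hv z0 r0 hz.1 hz.2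
  have f0 (u w : A) : S.form (v 0) (S.mul u w) = 0 := by simp [h.form_mul_skew hev _ w, r0]
  have e1 (u : A) : S.mul u (v 1) = -S.form (v 1) (S.mul u (v 3)) • v 0 +
      -S.form (v 1) (S.mul u (v 2)) • v 2 := by
    have e := hv.unit_eq_sum hA (S.mul u (v 1))
    rw [f0, h.form_mul_self hev, h.form_mul_skew hev _ (v 1) (v 3),
      h.form_mul_skew hev _ (v 1) (v 2)] at e
    simpa using e
  have e2 (u : A) : S.mul u (v 2) = -S.form (v 2) (S.mul u (v 3)) • v 0 +
      S.form (v 1) (S.mul u (v 2)) • v 1 := by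
    have e := hv.unit_eq_sum hA (S.mul u (v 2))
    rw [f0, h.form_mul_self hev, h.form_mul_skew hev _ (v 2) (v 3)] at e
    simpa using e
  have e3 (u : A) : S.mul u (v 3) = S.form (v 1) (S.mul u (v 3)) • v 1 +
      S.form (v 2) (S.mul u (v 3)) • v 2 := by
    have e := hv.unit_eq_sum hA (S.mul u (v 3))
    rw [f0, h.form_mul_self hev] at e
    simpa using e
  have h12 (u : A) : S.form (v 1) (S.mul u (v 2)) = 0 := by
    by_contra ha
    refine hz ⟨fun w => ?_, fun w => ?_⟩
    · have := h.mul_mul_eq_zero u (v 2) w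
      rw [e2] at this
      simpa [z0, ha] using this
    · have := h.mul_mul_eq_zero u (v 1) w
      rw [e1] at this
      simpa [z0, ha] using this
  have h21 (u : A) : S.form (v 2) (S.mul u (v 1)) = 0 := by
    rw [h.form_mul_skew hev, h12, neg_zero]
  have nz : ∃ u, S.form (v 0) u = 0 ∧ S.mul u (v 3) ≠ 0 := by
    by_contra! hc
    have (u : A) (hu : S.form (v 0) u = 0) (w : A) : S.mul u w = 0 := by
      have c1 : S.mul u (v 1) = 0 := by rw [e1, h12, hc u hu]; simp
      have c2 : S.mul u (v 2) = 0 := by rw [e2, h12, hc u hu]; simp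
      rw [hv.unit_eq_sum hA w]
      simp [r0, c1, c2, hc u hu]
    exact hz ⟨this _ (by simpa [unitGram] using hv 0 1), this _ (by simpa [unitGram] using hv 0 2)⟩
  obtain ⟨u, hu, huv⟩ := nz
  have nz : ∃ u w, S.form (v 0) u = 0 ∧ S.mul u w ≠ 0 := ⟨u, v 3, hu, huv⟩
  have zc := h.mul_mul_eq_zero u (v 3)
  rw [e3] at huv zc
  generalize S.form (v 1) (S.mul u (v 3)) = p at huv zc
  generalize S.form (v 2) (S.mul u (v 3)) = q at huv zc
  by_cases hpq : p * p + q * q = 0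
  · have hp : p ≠ 0 := by
      rintro rfl
      simp at hpq
      simp [hpq] at huv
    refine h.exists_A9_of_frame hA hev
      (v := ![v 0, p • v 1 + q • v 2, (2 * p * p)⁻¹ • (p • v 1 - q • v 2), v 3])
      ?_ z0 r0 zc ?_ nz
    · simp only [IsFrame, Fin.forall_fin_succ]
      simp [hv _ _, unitGram, splitGram]
      refine ⟨⟨hpq, ?_⟩, ?_, Or.inr hpq⟩ <;> field_simp <;> linear_combination -hpq
    · intro u
      simp [h12, h21, h.form_mul_self hev]
  · obtain ⟨r, hr⟩ := IsAlgClosed.exists_eq_mul_self (p * p + q * q)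
    have hr0 : r ≠ 0 := by rintro rfl; simp [hr] at hpq
    refine h.exists_A8_of_frame hA hev
      (v := ![v 0, r⁻¹ • (p • v 1 + q • v 2), r⁻¹ • (p • v 2 - q • v 1), v 3])
      ?_ z0 r0 (fun w => ?_) ?_ nz
    · simp only [IsFrame, Fin.forall_fin_succ]
      simp [hv _ _, unitGram]
      refine ⟨⟨?_, Or.inr (by ring)⟩, Or.inr (by ring), ?_⟩ <;> field_simp <;>
        linear_combination hr
    · change S.mul (r⁻¹ • (p • v 1 + q • v 2)) w = 0
      rw [map_smul, LinearMap.smul_apply, zc, smul_zero]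
    · intro u
      simp [h12, h21, h.form_mul_self hev]

end IsPseudoEuclideanNovikov

end AllEvenClassification

section EvenClassification

variable {K A : Type*} [Field K] [AddCommGroup A] [Module K A] {S : FormedSuperalgebra K A}

/-- The Gram matrix of two even vectors followed by an odd hyperbolic pair. -/
def symplecticGram {K : Type*} [Field K] (a b c : K) : Matrix (Fin 4) (Fin 4) K :=
  !![a, b, 0, 0; b, c, 0, 0; 0, 0, 0, 1; 0, 0, -1, 0]

theorem symplecticGram_mul_transpose {a b c : K} (h1 : a * a + b * b = 1)
    (h2 : a * b + b * c = 0) (h3 : b * b + c * c = 1) :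
    symplecticGram a b c * (symplecticGram a b c).transpose = 1 := by
  have h2' : b * a + c * b = 0 := by linear_combination h2
  ext i j
  fin_cases i <;> fin_cases j <;>
    simp [symplecticGram, Matrix.mul_apply, Fin.sum_univ_four, h1, h2, h2', h3]

namespace IsFrame

variable {v : Fin 4 → A}

theorem mul_transpose_hyperbolic :
    symplecticGram (0 : K) 1 0 * (symplecticGram (0 : K) 1 0).transpose = 1 :=
  symplecticGram_mul_transpose (by simp) (by simp) (by simp)

theorem mul_transpose_unit :
    symplecticGram (1 : K) 0 1 * (symplecticGram (1 : K) 0 1).transpose = 1 :=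
  symplecticGram_mul_transpose (by simp) (by simp) (by simp)

theorem hyperbolic_eq_sum (hv : S.IsFrame (symplecticGram 0 1 0) v)
    (hA : Module.finrank K A = 4) (x : A) :
    x = S.form (v 1) x • v 0 + S.form (v 0) x • v 1 + -S.form (v 3) x • v 2 +
      S.form (v 2) x • v 3 := by
  conv_lhs => rw [hv.eq_sum mul_transpose_hyperbolic hA x]
  simp [symplecticGram, Fin.sum_univ_four]

theorem unit_symplectic_eq_sum (hv : S.IsFrame (symplecticGram 1 0 1) v)
    (hA : Module.finrank K A = 4) (x : A) :
    x = S.form (v 0) x • v 0 + S.form (v 1) x • v 1 + -S.form (v 3) x • v 2 +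
      S.form (v 2) x • v 3 := by
  conv_lhs => rw [hv.eq_sum mul_transpose_unit hA x]
  simp [symplecticGram, Fin.sum_univ_four]

end IsFrame

namespace IsPseudoEuclideanNovikov

theorem symplecticFrame [CharZero K] (h : S.IsPseudoEuclideanNovikov) (he : S.FormIsEven)
    {v : Fin 4 → A}
    (h0 : v 0 ∈ S.part 0) (h1 : v 1 ∈ S.part 0) (h2 : v 2 ∈ S.part 1) (h3 : v 3 ∈ S.part 1)
    (h23 : S.form (v 2) (v 3) = 1) :
    S.IsFrame (symplecticGram (S.form (v 0) (v 0)) (S.form (v 0) (v 1)) (S.form (v 1) (v 1)))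
      v := by
  have self (f : A) (hf : f ∈ S.part 1) : S.form f f = 0 :=
    self_eq_neg.1 (by simpa using h.form_symm 1 1 f f hf hf)
  have h32 : S.form (v 3) (v 2) = -1 := by simpa [h23] using h.form_symm 1 1 _ _ h3 h2
  have c01 (x y : A) (hx : x ∈ S.part 0) (hy : y ∈ S.part 1) : S.form x y = 0 :=
    he 0 1 x y (by decide) hx hy
  have c10 (x y : A) (hx : x ∈ S.part 1) (hy : y ∈ S.part 0) : S.form x y = 0 :=
    he 1 0 x y (by decide) hx hy
  simp only [IsFrame, Fin.forall_fin_succ]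
  simp [symplecticGram, h23, h32, self _ h2, self _ h3, c01 _ _ h0 h2, c01 _ _ h0 h3,
    c01 _ _ h1 h2, c01 _ _ h1 h3, c10 _ _ h2 h0, c10 _ _ h2 h1, c10 _ _ h3 h0, c10 _ _ h3 h1,
    h.form_comm_of_even h1 (v 0)]

theorem form_mul_eq_zero (h : S.IsPseudoEuclideanNovikov) {i : ZMod 2} {x : A}
    (hx : x ∈ S.part i) (r : ∀ u, S.mul u x = 0) (u w : A) : S.form x (S.mul u w) = 0 := by
  revert u w
  refine h.homogeneous_induction (fun u v hu hv w => by simp [hu, hv]) fun j u hu => ?_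
  refine h.homogeneous_induction (fun v w hv hw => by simp [hv, hw]) fun k w hw => ?_
  rw [h.form_symm _ _ _ _ hx (h.mul_mem _ _ _ _ hu hw), h.left_antisymm j k u w x hu hw, r]
  simp

theorem form_mul_even_self [CharZero K] (h : S.IsPseudoEuclideanNovikov) {u x : A}
    (hu : u ∈ S.part 0) (hx : x ∈ S.part 0) : S.form x (S.mul u x) = 0 := by
  have := h.left_antisymm_of_even hu x x
  rw [← h.form_comm_of_even hx] at this
  exact self_eq_neg.1 this

theorem form_odd_mul_odd (h : S.IsPseudoEuclideanNovikov) {f g x : A} (hf : f ∈ S.part 1)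
    (hg : g ∈ S.part 1) (hx : x ∈ S.part 0) : S.form x (S.mul f g) = S.form g (S.mul f x) := by
  rw [h.form_comm_of_even hx, h.left_antisymm 1 1 f g x hf hg]
  simp

theorem exists_A13_of_frame [CharZero K] (h : S.IsPseudoEuclideanNovikov) (he : S.FormIsEven)
    (hA : Module.finrank K A = 4) {v : Fin 4 → A} (h0 : v 0 ∈ S.part 0) (h1 : v 1 ∈ S.part 0)
    (h2 : v 2 ∈ S.part 1) (h3 : v 3 ∈ S.part 1) (hv : S.IsFrame (symplecticGram 0 1 0) v)
    (z0 : ∀ w, S.mul (v 0) w = 0) (r0 : ∀ u, S.mul u (v 0) = 0) (z2 : ∀ w, S.mul (v 2) w = 0)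
    (e12 : S.mul (v 1) (v 2) = 0) (nz : ∃ f ∈ S.part 1, S.mul f (v 1) ≠ 0) :
    ∃ M : FormedSuperalgebra K (Fin 4 → K), EvenModel M ∧ S.Isomorphic M := by
  have c01 (x y : A) (hx : x ∈ S.part 0) (hy : y ∈ S.part 1) : S.form x y = 0 :=
    he 0 1 x y (by decide) hx hy
  have c10 (x y : A) (hx : x ∈ S.part 1) (hy : y ∈ S.part 0) : S.form x y = 0 :=
    he 1 0 x y (by decide) hx hy
  have ev (u w : A) (hx : S.mul u w ∈ S.part 0) : S.mul u w = S.form (v 1) (S.mul u w) • v 0 := by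
    have e := hv.hyperbolic_eq_sum hA (S.mul u w)
    rw [c10 _ _ h2 hx, c10 _ _ h3 hx, h.form_mul_eq_zero h0 r0] at e
    simpa using e
  have od (x : A) (hx : x ∈ S.part 1) :
      x = -S.form (v 3) x • v 2 + S.form (v 2) x • v 3 := by
    have e := hv.hyperbolic_eq_sum hA x
    rw [c01 _ _ h0 hx, c01 _ _ h1 hx] at e
    simpa using e
  have m31 : S.mul (v 3) (v 1) ∈ S.part 1 := h.mul_mem' h3 h1 rfl
  have m13 : S.mul (v 1) (v 3) ∈ S.part 1 := h.mul_mem' h1 h3 rfl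
  have nz3 : S.mul (v 3) (v 1) ≠ 0 := by
    obtain ⟨f, hf, hfv⟩ := nz
    intro h31
    apply hfv
    rw [od f hf]
    simp [z2, h31]
  have t0 : S.form (v 2) (S.mul (v 3) (v 1)) = 0 := by
    have hz := h.mul_mul_eq_zero (v 3) (v 1) (v 1)
    rw [od _ m31] at hz
    simpa [z2, nz3] using hz
  have e31 := od _ m31
  have e11 := ev _ _ (h.mul_mem' h1 h1 rfl)
  have e32 := ev _ _ (h.mul_mem' h3 h2 one_add_one_zmod_two)
  have e33 := ev _ _ (h.mul_mem' h3 h3 one_add_one_zmod_two)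
  have e13 := od _ m13
  rw [h.form_odd_mul_odd h3 h2 h1, t0, zero_smul] at e32
  rw [h.form_odd_mul_odd h3 h3 h1] at e33
  rw [h.form_mul_even_self h1 h1, zero_smul] at e11
  rw [t0, zero_smul, add_zero] at e31
  have s0 : S.form (v 2) (S.mul (v 1) (v 3)) = 0 := by
    rw [h.form_symm 1 1 _ _ h2 m13, h.left_antisymm_of_even h1, e12]
    simp
  rw [s0, zero_smul, add_zero] at e13
  have hl : S.form (v 3) (S.mul (v 3) (v 1)) ≠ 0 := by
    intro hl
    rw [hl] at e31
    exact nz3 (by simpa using e31)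
  refine ⟨_, .A13 _ (-S.form (v 3) (S.mul (v 1) (v 3))) hl, ?_⟩
  rw [A13, ofTable_eq_vecCons]
  refine hv.isomorphic_ofTable IsFrame.mul_transpose_hyperbolic hA h.toIsSuperalgebra
    (by simp [Fin.forall_fin_succ, h0, h1, h2, h3]) ?_
  simp [Fin.forall_fin_succ, Fin.sum_univ_four, z0, r0, z2, e11, e12, e32]
  exact ⟨by simpa using e13, by simpa using e31, e33⟩

theorem even_exists_model_of_even_radical [IsAlgClosed K] [CharZero K]
    (h : S.IsPseudoEuclideanNovikov) (he : S.FormIsEven) (hA : Module.finrank K A = 4) {e : A}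
    (hei : e ∈ S.part 0) (he0 : e ≠ 0) (hes : e ∈ S.square) (ee : S.form e e = 0)
    (z : ∀ w, S.mul e w = 0) (r : ∀ u, S.mul u e = 0) :
    ∃ M : FormedSuperalgebra K (Fin 4 → K), EvenModel M ∧ S.Isomorphic M := by
  obtain ⟨d, hdi, ed, dd⟩ := h.even_exists_hyperbolic he hei he0 ee
  by_cases hodd : ∃ y ∈ S.part 1, y ≠ 0
  · obtain ⟨y, hy, hy0⟩ := hodd
    obtain ⟨y', hy', hyy'⟩ := h.even_exists_form_ne_zero he hy hy0
    have frame (f g : A) (hf : f ∈ S.part 1) (hg : g ∈ S.part 1) (hfg : S.form f g = 1) :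
        S.IsFrame (symplecticGram 0 1 0) ![e, d, f, g] := by
      have := h.symplecticFrame he (v := ![e, d, f, g]) hei hdi hf hg hfg
      simpa [ee, ed, dd] using this
    have hv := frame y y' hy hy' hyy'
    have ev (x : A) (hx : x ∈ S.part 0) : x = S.form d x • e + S.form e x • d := by
      have := hv.hyperbolic_eq_sum hA x
      simpa [he 1 0 _ _ (by decide) hy hx, he 1 0 _ _ (by decide) hy' hx] using this
    have hdd : S.mul d d = 0 := by
      rw [ev _ (h.mul_mem' hdi hdi rfl), h.form_mul_eq_zero hei r, h.form_mul_even_self hdi hdi]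
      simp
    have nz : ∃ u ∈ S.part 1, S.mul u d ≠ 0 := by
      by_contra! hc
      refine he0 (h.eq_zero_of_mem hei ?_)
      have hle : S.square ≤ S.part 1 := by
        refine Submodule.span_le.2 ?_
        rintro _ ⟨u, w, rfl⟩
        obtain ⟨u₀, hu₀, u₁, hu₁, rfl⟩ := h.exists_add u
        obtain ⟨w₀, hw₀, w₁, hw₁, rfl⟩ := h.exists_add w
        have k00 : S.mul u₀ w₀ = 0 := by
          rw [ev _ hu₀, ev _ hw₀]
          simp [z, r, hdd]
        have k11 : S.mul u₁ w₁ = 0 := by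
          rw [ev _ (h.mul_mem' hu₁ hw₁ one_add_one_zmod_two), h.form_mul_eq_zero hei r,
            h.form_odd_mul_odd hu₁ hw₁ hdi, hc _ hu₁]
          simp
        have k : S.mul (u₀ + u₁) (w₀ + w₁) = S.mul u₀ w₁ + S.mul u₁ w₀ := by
          simp [k00, k11, add_comm]
        rw [SetLike.mem_coe, k]
        exact add_mem (h.mul_mem' hu₀ hw₁ rfl) (h.mul_mem' hu₁ hw₀ rfl)
      exact hle hes
    obtain ⟨u, hu, hud⟩ := nz
    have hf : S.mul u d ∈ S.part 1 := h.mul_mem' hu hdi rfl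
    obtain ⟨g, hg, hfg⟩ := h.even_exists_form_ne_zero he hf hud
    refine h.exists_A13_of_frame he hA (v := ![e, d, S.mul u d, g]) hei hdi hf hg
      (frame _ g hf hg hfg) z r (h.mul_mul_eq_zero u d) ?_ ⟨u, hu, hud⟩
    change S.mul d (S.mul u d) = 0
    rw [h.mul_left_supercomm hdi hu, hdd]
    simp
  · push Not at hodd
    have hev (u : A) : u ∈ S.part 0 := by
      obtain ⟨u₀, h₀, u₁, h₁, rfl⟩ := h.exists_add u
      simpa [hodd u₁ h₁] using h₀
    obtain ⟨j, x, hx, hx0, hxo⟩ := h.exists_orthogonal hA (Or.inl he) (n := 2) (by norm_num)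
      ![e, d] (fun k => ⟨0, hev _⟩)
    obtain ⟨b₁, hb₁, b₂, hb₂, b11, b22, b12, eb1, db1, eb2, db2⟩ :=
      h.even_exists_orthonormal_pair he hA hei hdi ee ed dd (hev x) hx0 (hxo 0) (hxo 1)
    refine h.even_exists_model_of_forall_even hA hev (v := ![e, b₁, b₂, d]) ?_ z r
    have comm (x y : A) : S.form x y = S.form y x := h.form_comm_of_even (hev x) y
    simp only [IsFrame, Fin.forall_fin_succ]
    simp [unitGram, b11, b22, b12, eb1, db1, eb2, db2, ee, ed, dd, comm d e, comm b₁ e, comm b₁ d,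
      comm b₂ e, comm b₂ d, comm b₂ b₁]

theorem even_exists_model_of_odd_radical [IsAlgClosed K] [CharZero K]
    (h : S.IsPseudoEuclideanNovikov) (he : S.FormIsEven) (hA : Module.finrank K A = 4) {e : A}
    (hei : e ∈ S.part 1) (he0 : e ≠ 0) (hes : e ∈ S.square) (ee : S.form e e = 0)
    (z : ∀ w, S.mul e w = 0) (r : ∀ u, S.mul u e = 0) :
    ∃ M : FormedSuperalgebra K (Fin 4 → K), EvenModel M ∧ S.Isomorphic M := by
  obtain ⟨d, hdi, ed, dd⟩ := h.even_exists_hyperbolic he hei he0 ee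
  have heven : ∃ x ∈ S.part 0, x ≠ 0 := by
    by_contra! hc
    have hle : S.square ≤ ⊥ := by
      refine Submodule.span_le.2 ?_
      rintro _ ⟨u, w, rfl⟩
      obtain ⟨u₀, hu₀, u₁, hu₁, rfl⟩ := h.exists_add u
      obtain ⟨w₀, hw₀, w₁, hw₁, rfl⟩ := h.exists_add w
      simp [hc _ hu₀, hc _ hw₀, hc _ (h.mul_mem' hu₁ hw₁ one_add_one_zmod_two)]
    exact he0 (by simpa using hle hes)
  obtain ⟨x, hx, hx0⟩ := heven
  obtain ⟨b₁, hb₁, b₂, hb₂, b11, b22, b12, -⟩ :=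
    h.even_exists_orthonormal_pair he hA hei hdi ee ed dd hx hx0
      (he 1 0 _ _ (by decide) hei hx) (he 1 0 _ _ (by decide) hdi hx)
  have hv : S.IsFrame (symplecticGram 1 0 1) ![b₁, b₂, e, d] := by
    have := h.symplecticFrame he (v := ![b₁, b₂, e, d]) hb₁ hb₂ hei hdi ed
    simpa [b11, b12, b22] using this
  have ev (x : A) (hx : x ∈ S.part 0) : x = S.form b₁ x • b₁ + S.form b₂ x • b₂ := by
    have := hv.unit_symplectic_eq_sum hA x
    simpa [he 1 0 _ _ (by decide) hei hx, he 1 0 _ _ (by decide) hdi hx] using this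
  have od (x : A) (hx : x ∈ S.part 1) : x = -S.form d x • e + S.form e x • d := by
    have := hv.unit_symplectic_eq_sum hA x
    simpa [he 0 1 _ _ (by decide) hb₁ hx, he 0 1 _ _ (by decide) hb₂ hx] using this
  have skew (u x y : A) (hu : u ∈ S.part 0) (hy : y ∈ S.part 0) :
      S.form y (S.mul u x) = -S.form x (S.mul u y) := by
    rw [h.form_comm_of_even hy, h.left_antisymm_of_even hu]
  have evev (u w : A) (hu : u ∈ S.part 0) (hw : w ∈ S.part 0) : S.mul u w = 0 := by
    have e1 := ev _ (h.mul_mem' hu hb₁ rfl)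
    have e2 := ev _ (h.mul_mem' hu hb₂ rfl)
    rw [h.form_mul_even_self hu hb₁, skew u b₁ b₂ hu hb₂] at e1
    rw [h.form_mul_even_self hu hb₂] at e2
    by_cases ha : S.form b₁ (S.mul u b₂) = 0
    · rw [ha] at e1 e2
      rw [ev w hw, map_add, map_smul, map_smul, e1, e2]
      simp
    · have z1 (w : A) : S.mul b₁ w = 0 := by
        have := h.mul_mul_eq_zero u b₂ w
        rw [e2] at this
        simpa [ha] using this
      have z2 (w : A) : S.mul b₂ w = 0 := by
        have := h.mul_mul_eq_zero u b₁ w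
        rw [e1] at this
        simpa [ha] using this
      rw [ev u hu]
      simp [z1, z2]
  have evd (u : A) (hu : u ∈ S.part 0) : S.mul u d = -S.form d (S.mul u d) • e := by
    have := od _ (h.mul_mem' hu hdi (zero_add 1))
    rw [h.form_mul_eq_zero hei r, zero_smul, add_zero] at this
    exact this
  have dev (x : A) (hx : x ∈ S.part 0) : S.mul d x = -S.form x (S.mul d d) • e := by
    have := od _ (h.mul_mem' hdi hx (add_zero 1))
    rw [h.form_mul_eq_zero hei r, zero_smul, add_zero, ← h.form_odd_mul_odd hdi hdi hx] at this
    exact this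
  have hddi : S.mul d d ∈ S.part 0 := h.mul_mem' hdi hdi one_add_one_zmod_two
  by_cases hdd : S.mul d d = 0
  · refine ⟨_, .A12 (-S.form d (S.mul b₁ d)) (-S.form d (S.mul b₂ d)) 1 (Or.inl rfl), ?_⟩
    rw [A12, ofTable_eq_vecCons]
    refine hv.isomorphic_ofTable IsFrame.mul_transpose_unit hA h.toIsSuperalgebra
      (by simp [Fin.forall_fin_succ, hb₁, hb₂, hei, hdi]) ?_
    simp [Fin.forall_fin_succ, Fin.sum_univ_four, z, r, hdd, evev _ _ hb₁ hb₁, evev _ _ hb₁ hb₂,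
      evev _ _ hb₂ hb₁, evev _ _ hb₂ hb₂, dev _ hb₁, dev _ hb₂]
    exact ⟨by simpa using evd _ hb₁, by simpa using evd _ hb₂⟩
  · have hddd : S.mul d (S.mul d d) = 0 := by
      have hc : S.mul d (S.mul d d) = -S.mul d (S.mul d d) := by
        simpa using h.mul_left_supercomm hdi hdi d
      have h2 : (2 : K) • S.mul d (S.mul d d) = 0 := by
        rw [two_smul]
        exact eq_neg_iff_add_eq_zero.1 hc
      exact (smul_eq_zero.1 h2).resolve_left two_ne_zero
    have hiso : S.form (S.mul d d) (S.mul d d) = 0 := by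
      have := dev _ hddi
      rw [hddd] at this
      simpa [he0] using this.symm
    obtain ⟨b, hb, hddb, hbb⟩ := h.even_exists_hyperbolic he hddi hdd hiso
    have hv' : S.IsFrame (symplecticGram 0 1 0) ![S.mul d d, b, e, d] := by
      have := h.symplecticFrame he (v := ![S.mul d d, b, e, d]) hddi hb hei hdi ed
      simpa [hiso, hddb, hbb] using this
    refine h.exists_A13_of_frame he hA (v := ![S.mul d d, b, e, d]) hddi hb hei hdi hv'
      (h.mul_mul_eq_zero d d) (fun u => ?_) z (r b) ⟨d, hdi, ?_⟩
    · change S.mul u (S.mul d d) = 0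
      obtain ⟨u₀, hu₀, u₁, hu₁, rfl⟩ := h.exists_add u
      rw [map_add, LinearMap.add_apply, evev _ _ hu₀ hddi, od _ hu₁]
      simp [z, hddd]
    · change S.mul d b ≠ 0
      rw [dev b hb, h.form_comm_of_even hb, hddb]
      simpa using he0

theorem even_exists_model [IsAlgClosed K] [CharZero K] (h : S.IsPseudoEuclideanNovikov)
    (he : S.FormIsEven) (hA : Module.finrank K A = 4) (hd : S.SquareDegenerate) :
    ∃ M : FormedSuperalgebra K (Fin 4 → K), EvenModel M ∧ S.Isomorphic M := by
  obtain ⟨i, x, hx, hx0, hxs, hxx, z, r⟩ := h.even_exists_radical he hd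
  rcases zmod_two_eq_zero_or_one i with rfl | rfl
  · exact h.even_exists_model_of_even_radical he hA hx hx0 hxs hxx z r
  · exact h.even_exists_model_of_odd_radical he hA hx hx0 hxs hxx z r

end IsPseudoEuclideanNovikov

end EvenClassification

end FormedSuperalgebra

theorem mainTheorem8 (K : Type*) [Field K] [IsAlgClosed K] [CharZero K] :
    -- the listed superalgebras are even, respectively odd, pseudo-Euclidean Novikov superalgebras
    (∀ M : FormedSuperalgebra K (Fin 4 → K), FormedSuperalgebra.EvenModel M →
      M.IsPseudoEuclideanNovikov ∧ M.FormIsEven) ∧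
    (∀ M : FormedSuperalgebra K (Fin 4 → K), FormedSuperalgebra.OddModel M →
      M.IsPseudoEuclideanNovikov ∧ M.FormIsOdd) ∧
    -- the even list is complete when the product space is degenerate
    (∀ (A : Type*) [AddCommGroup A] [Module K A] (S : FormedSuperalgebra K A),
      S.IsPseudoEuclideanNovikov → S.FormIsEven → Module.finrank K A = 4 → S.SquareDegenerate →
        ∃ M : FormedSuperalgebra K (Fin 4 → K), FormedSuperalgebra.EvenModel M ∧ S.Isomorphic M) ∧
    -- the odd list is complete
    (∀ (A : Type*) [AddCommGroup A] [Module K A] (S : FormedSuperalgebra K A),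
      S.IsPseudoEuclideanNovikov → S.FormIsOdd → Module.finrank K A = 4 →
        ∃ M : FormedSuperalgebra K (Fin 4 → K), FormedSuperalgebra.OddModel M ∧
          S.Isomorphic M) := by
  exact ⟨fun _ hM => hM.laws, fun _ hM => hM.laws,
    fun _ _ _ _ h he hA hd => h.even_exists_model he hA hd,
    fun _ _ _ _ h ho hA => h.odd_exists_model ho hA⟩
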